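/- **Lemma (Simple quantum hill climber).** A weighted MAX-$k$-SAT instance on $n$ variables consists of clauses $C_1,\dots,C_m$, each a disjunction of at most $k$ literals, and real weights $w_1,\dots,w_m$; its objective function is $\varphi(x)=\sum_{i=1}^m w_iC_i(x)$ for $x\in\{0,1\}^n$. For $d\ge 0$ let $\mathcal N_d(x)$ be the set of strings $y\neq x$ that differ from $x$ in at most $d$ bits, and let $f_d(x)$ be the fraction of the $y\in\mathcal N_d(x)$ with $\varphi(y)>\varphi(x)$. Put $B_d(x)=\sqrt{1/f_d(x)}$ if some $y\in\mathcal N_d(x)$ has $\varphi(y)>\varphi(x)$, and $B_d(x)=\sqrt{|\mathcal N_d(x)|}$ if there is none. The classical simple hill climber with at most $T$ steps starts at a string $x_0$ and in each step moves from the current string $x_t$ to a uniformly random $y\in\mathcal N_d(x_t)$ with $\varphi(y)>\varphi(x_t)$; it stops if there is no such $y$, or after $T$ steps. For $y\in\{0,1\}^n$ let $f_y(x)=1$ if $\varphi(x)>\varphi(y)$ and $f_y(x)=0$ otherwise, and let $\mathcal O_{f_y}|x\rangle|b\rangle=|x\rangle|b\oplus f_y(x)\rangle$; one application of $\mathcal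 O_{f_y}$ is implemented with four calls to $\varphi$ and is counted as such. There is an absolute constant $C>0$ such that the following holds for all $n,d$ and all $T\ge 1$. Let $\varepsilon=1-(2/3)^{1/T}$ (so that $\log(1/\varepsilon)\le\log(3T)$). There are quantum algorithms $S_x$ ($x\in\{0,1\}^n$), which depend on $n,d,T$ only and access $\varphi$ only through the oracles $\mathcal O_{f_y}$, such that for every $k$ and every MAX-$k$-SAT instance $\varphi$ on $n$ variables: 1. For every $x$, if some $y\in\mathcal N_d(x)$ has $\varphi(y)>\varphi(x)$, then $S_x$ returns such a $y$ with probability at least $1-\varepsilon$; if there is none, $S_x$ reports this with certainty. In both cases $S_x$ makes in expectation at most $C\log(1/\varepsilon)\,B_d(x)$ calls to $\varphi$. 2. Let the *simple quantum hill climber* be the algorithm obtained from the classical one by replacing the local search step at each current string $x$ by a run of $S_x$ (moving to the returned string, and stopping if none is returned). For every initial string $x_0$, with probability at least $2/3$ it behaves identically to the classical simple hill climber started at $x_0$; that is, the sequences of strings visited by the two can be coupled so that they are equal with probability at least $2/3$. 3. For every $x_0$, the expected number of calls to $\varphi$ made by the simple quantum hill climber is at most $$\mathbb E\Big[\sum_t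 C\,\log(1/\varepsilon)\,B_d(x_t)\Big],$$ the sum being over the at most $T$ strings $x_t$ of its run at which it performs a local search. In other words, it is $\sum_t\tilde O\big(\sqrt{1/f_{d,t}}\big)$ with $f_{d,t}=f_d(x_t)$, where a concluding search at a local maximum counts with $\sqrt{|\mathcal N_d(x_t)|}$ in place of $\sqrt{1/f_{d,t}}$. -/

import Mathlib

open scoped ENNReal Matrix

noncomputable section

/-- Bit strings of length `n`. -/
abbrev Bits (n : ℕ) : Type := Fin n → Bool

/-! ### Weighted MAX-k-SAT and the local search landscape -/

/-- A weighted MAX-`k`-SAT instance on `n` variables: `m` clauses with real weights, each clause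
being a disjunction of at most `k` literals. The literal `(i, b)` is true iff variable `i` has
value `b`. -/
structure MaxKSat (n k : ℕ) where
  m : ℕ
  clause : Fin m → Finset (Fin n × Bool)
  card_le : ∀ i, (clause i).card ≤ k
  weight : Fin m → ℝ

/-- The objective function: the total weight of the satisfied clauses. -/
def MaxKSat.objective {n k : ℕ} (I : MaxKSat n k) (x : Bits n) : ℝ :=
  ∑ i : Fin I.m, if ∃ l ∈ I.clause i, x l.1 = l.2 then I.weight i else 0

/-- The `d`-level neighbourhood: all other strings within `d` bit flips. -/
def neighbourhood {n : ℕ} (d : ℕ) (x : Bits n) : Finset (Bits n) :=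
  Finset.univ.filter fun y => y ≠ x ∧ hammingDist x y ≤ d

/-- The marking function `f_y`, with `f_y(x) = 1` iff `φ(x) > φ(y)`. -/
def marking {n : ℕ} (φ : Bits n → ℝ) (y x : Bits n) : Bool :=
  decide (φ x > φ y)

/-- The neighbours of `x` with strictly larger objective value. -/
def improving {n : ℕ} (φ : Bits n → ℝ) (d : ℕ) (x : Bits n) : Finset (Bits n) :=
  (neighbourhood d x).filter fun y => marking φ x y = true

/-- The fraction of the neighbours of `x` that are improving. -/
def improvingFraction {n : ℕ} (φ : Bits n → ℝ) (d : ℕ) (x : Bits n) : ℝ :=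
  ((improving φ d x).card : ℝ) / ((neighbourhood d x).card : ℝ)

/-- `√(1/f)` where `f` is the fraction of improving neighbours of `x`. At a local maximum, where
`f = 0`, a search has to establish that nothing is marked among the neighbours; there the value is
the square root of the size of the neighbourhood. -/
def searchBound {n : ℕ} (φ : Bits n → ℝ) (d : ℕ) (x : Bits n) : ℝ :=
  if (improving φ d x).Nonempty then √(1 / improvingFraction φ d x)
  else √((neighbourhood d x).card : ℝ)

/-- The classical simple hill climber with at most `T` local search steps, started at the given
string. A step moves to a uniformly random strictly improving neighbour; the climber stops when
there is none or after `T` steps. The result is the random list of the visited strings. -/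
def classicalHillClimber {n : ℕ} (φ : Bits n → ℝ) (d : ℕ) : ℕ → Bits n → PMF (List (Bits n))
  | 0, x => PMF.pure [x]
  | T + 1, x =>
    open Classical in
    if h : (improving φ d x).Nonempty then
      (PMF.uniformOfFinset (improving φ d x) h).bind fun y =>
        (classicalHillClimber φ d T y).map fun l => x :: l
    else PMF.pure [x]

/-! ### Calls to `φ` made by one application of the oracle `O_{f_y}` -/

/-- Reversible steps on `(x, b, r, s)`, where `r`, `s` are scratch registers for values of `φ`. -/
inductive PhiStep where
  | evalArg
  | evalRef
  | compare
  | unevalArg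
  | unevalRef

/-- The action of a reversible step on a basis state. -/
def PhiStep.act {n : ℕ} (φ : Bits n → ℝ) (y : Bits n) :
    PhiStep → Bits n × Bool × ℝ × ℝ → Bits n × Bool × ℝ × ℝ
  | .evalArg, (x, b, r, s) => (x, b, r + φ x, s)
  | .evalRef, (x, b, r, s) => (x, b, r, s + φ y)
  | .compare, (x, b, r, s) => (x, b ^^ decide (r > s), r, s)
  | .unevalArg, (x, b, r, s) => (x, b, r - φ x, s)
  | .unevalRef, (x, b, r, s) => (x, b, r, s - φ y)

/-- The number of calls to `φ` made by a step. -/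
def PhiStep.calls : PhiStep → ℕ
  | .compare => 0
  | _ => 1

/-- Compute `φ(x)` and `φ(y)`, compare them, and uncompute. -/
def oracleCircuit : List PhiStep :=
  [.evalArg, .evalRef, .compare, .unevalRef, .unevalArg]

/-- The circuit implements `|x⟩|b⟩ ↦ |x⟩|b ⊕ f_y(x)⟩` and leaves the scratch registers clean. -/
theorem oracleCircuit_spec {n : ℕ} (φ : Bits n → ℝ) (y x : Bits n) (b : Bool) :
    oracleCircuit.foldl (fun st g => g.act φ y st) (x, b, 0, 0)
      = (x, b ^^ marking φ y x, 0, 0) := by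
  simp [oracleCircuit, PhiStep.act, marking]

/-- The number of calls to `φ` that one application of `O_{f_y}` takes. -/
def callsPerOracle : ℕ := (oracleCircuit.map PhiStep.calls).sum

/-! ### Quantum algorithms with oracle access to the `O_{f_y}` -/

/-- Computational basis: an `n`-qubit argument register, one target qubit, `a` work qubits. -/
abbrev QBasis (n a : ℕ) : Type := Bits n × Bool × Bits a

/-- (Sub-normalised) state vectors. -/
abbrev QVec (n a : ℕ) : Type := QBasis n a → ℂ

/-- The state `|0…0⟩`. -/
def zeroState (n a : ℕ) : QVec n a :=
  Pi.single (fun _ => false, false, fun _ => false) 1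

/-- The squared norm of a vector; for a sub-normalised state, the probability of its branch. -/
def weight {n a : ℕ} (ψ : QVec n a) : ℝ≥0∞ := ∑ b, ‖ψ b‖ₑ ^ 2

/-- The oracle `O_{f_y} : |x⟩|b⟩|w⟩ ↦ |x⟩|b ⊕ f_y(x)⟩|w⟩`. -/
def applyOracle {n a : ℕ} (φ : Bits n → ℝ) (y : Bits n) (ψ : QVec n a) : QVec n a :=
  fun s => ψ (s.1, s.2.1 ^^ marking φ y s.1, s.2.2)

/-- The projection onto the span of the basis states `b` with `r b = j`. -/
def project {n a m : ℕ} (r : QBasis n a → Fin m) (j : Fin m) (ψ : QVec n a) : QVec n a :=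
  fun b => if r b = j then ψ b else 0

/-- Adaptive quantum query algorithms with classical control and classical output in `α`. They do
not refer to `φ`, which enters only through the oracle gates when the algorithm is run. -/
inductive QProg (n a : ℕ) (α : Type) : Type where
  /-- Stop with the given output. -/
  | done (o : α) : QProg n a α
  /-- Discard the registers and prepare `|0…0⟩`. -/
  | init (p : QProg n a α) : QProg n a α
  /-- Apply a unitary that is independent of the oracles. -/
  | gate (U : Matrix.unitaryGroup (QBasis n a) ℂ) (p : QProg n a α) : QProg n a α
  /-- Apply `O_{f_y}`. -/
  | oracle (y : Bits n) (p : QProg n a α) : QProg n a α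
  /-- Measure the function `r` of the computational basis; continue according to the outcome. -/
  | measure (m : ℕ) (r : QBasis n a → Fin m) (p : Fin m → QProg n a α) : QProg n a α
  /-- Draw a classical uniformly random number from `{0, …, m}`. -/
  | sample (m : ℕ) (p : Fin (m + 1) → QProg n a α) : QProg n a α

namespace QProg

variable {n a : ℕ} {α β : Type}

/-- Run an algorithm and then another one that depends on its output. -/
def bind : QProg n a α → (α → QProg n a β) → QProg n a β
  | done o, q => q o
  | init p, q => init (p.bind q)
  | gate U p, q => gate U (p.bind q)
  | oracle y p, q => oracle y (p.bind q)
  | measure m r p, q => measure m r fun j => (p j).bind q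
  | sample m p, q => sample m fun j => (p j).bind q

/-- The probability that the algorithm, run on the state `ψ`, outputs `o`. -/
def prob (φ : Bits n → ℝ) : QProg n a α → QVec n a → α → ℝ≥0∞
  | done o', ψ, o => open Classical in if o' = o then weight ψ else 0
  | init p, ψ, o => weight ψ * p.prob φ (zeroState n a) o
  | gate U p, ψ, o => p.prob φ ((U : Matrix (QBasis n a) (QBasis n a) ℂ) *ᵥ ψ) o
  | oracle y p, ψ, o => p.prob φ (applyOracle φ y ψ) o
  | measure _ r p, ψ, o => ∑ j, (p j).prob φ (project r j ψ) o
  | sample m p, ψ, o => ((m + 1 : ℕ) : ℝ≥0∞)⁻¹ * ∑ j, (p j).prob φ ψ o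

/-- The expected number of calls to `φ` of the algorithm when it is run on the state `ψ`: each
application of an oracle contributes `callsPerOracle`, weighted by the probability of the branch. -/
def calls (φ : Bits n → ℝ) : QProg n a α → QVec n a → ℝ≥0∞
  | done _, _ => 0
  | init p, ψ => weight ψ * p.calls φ (zeroState n a)
  | gate U p, ψ => p.calls φ ((U : Matrix (QBasis n a) (QBasis n a) ℂ) *ᵥ ψ)
  | oracle y p, ψ => callsPerOracle * weight ψ + p.calls φ (applyOracle φ y ψ)
  | measure _ r p, ψ => ∑ j, (p j).calls φ (project r j ψ)
  | sample m p, ψ => ((m + 1 : ℕ) : ℝ≥0∞)⁻¹ * ∑ j, (p j).calls φ ψ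

/-- The probability of the output `o` when the algorithm starts in `|0…0⟩`. -/
def outputProb (φ : Bits n → ℝ) (p : QProg n a α) (o : α) : ℝ≥0∞ :=
  p.prob φ (zeroState n a) o

/-- The expected number of calls to `φ` when the algorithm starts in `|0…0⟩`. -/
def expectedCalls (φ : Bits n → ℝ) (p : QProg n a α) : ℝ≥0∞ :=
  p.calls φ (zeroState n a)

end QProg

/-- The hill climber with at most `T` steps in which each local search at the current string `x` is
a run of the quantum algorithm `S x` on fresh registers. On `some y` it moves to `y`, on `none` it
stops. The output is the list of the visited strings. -/
def quantumHillClimber {n a : ℕ} (S : Bits n → QProg n a (Option (Bits n))) :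
    ℕ → Bits n → QProg n a (List (Bits n))
  | 0, x => .done [x]
  | T + 1, x => .init ((S x).bind fun
    | none => .done [x]
    | some y => (quantumHillClimber S T y).bind fun l => .done (x :: l))

/-- For the objective `φ`, every `S x` is a quantum search, with error at most `ε`, for a strictly
improving string in the `d`-level neighbourhood of `x`, that makes at most `B x` calls to `φ` in
expectation; if there is no such string it reports this with certainty. -/
structure IsLocalQSearch {n a : ℕ} (φ : Bits n → ℝ) (d : ℕ) (ε : ℝ) (B : Bits n → ℝ)
    (S : Bits n → QProg n a (Option (Bits n))) : Prop where
  finds : ∀ x, (improving φ d x).Nonempty →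
    ENNReal.ofReal (1 - ε) ≤ ∑ y ∈ improving φ d x, (S x).outputProb φ (some y)
  confirms : ∀ x, ¬ (improving φ d x).Nonempty → (S x).outputProb φ none = 1
  calls_le : ∀ x, (S x).expectedCalls φ ≤ ENNReal.ofReal (B x)

/-- The error `1 - (2/3)^{1/T}` allowed to each of `T` local searches. -/
def stepError (T : ℕ) : ℝ := 1 - (2 / 3 : ℝ) ^ (1 / (T : ℝ))

end

/-!
A local search at `x` is a Grover search in the neighbourhood of `x`, in the form that does not know
the number `t` of improving strings among the `N` neighbours. It is built from trials. A trial
prepares the uniform superposition of the neighbours (`searchVec`), applies a uniformly random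
number `j ≤ m` of Grover iterations, measures, and verifies the outcome with one more query. With
`sin² θ = t / (2 N)`, the amplitudes after `j` iterations are governed by the angle `(2 j + 1) θ`
(`groverState_eq`), and averaging `sin² ((2 j + 1) θ)` over `j` shows that a trial succeeds with
probability at least `1/4` as soon as `m + 1 ≥ √(N/t)` (`missProb_le`). Keeping the target qubit in
`|0⟩` halves the marked weight, so that `θ ≤ π/4` and a large `t` needs no separate treatment.

A search makes three trials for each of `m + 1 = 1, 2, 4, …` up to about `√N`. Beyond the threshold
`√(N/t)` the next phase is reached with conditional probability at most `(3/4)³ < 1/2`, which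
outweighs the doubling of its cost; hence the expected cost is `O(√(N/t))`, and it is `O(√N)` if
`t = 0` (`costBound_phases_append_of_threshold`, `costBound_phases_append`). All of this is repeated
`O(log(1/ε))` times, until a verification succeeds, to bring the error down to `ε`.

All improving strings have the same amplitudes throughout, so each of them is output with the same
probability, and nothing else than improving strings and `none` is output. The two hill climbers
can therefore be coupled to move together whenever the search succeeds; as the search errs with
probability at most `ε`, they agree with probability at least `(1 - ε)^T = 2/3` (`exists_coupling`).
The bound on the number of calls is the sum of the bounds for the single searches, which run on
fresh registers and thus depend on the past through the current string only (`IsFresh`).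
-/

noncomputable section

/-! ### The probabilistic semantics of query algorithms -/

section Semantics

variable {n a : ℕ} {α β : Type}

lemma weight_zeroState : weight (zeroState n a) = 1 := by
  unfold weight zeroState
  rw [Finset.sum_eq_single ((fun _ => false, false, fun _ => false) : QBasis n a)]
  · simp
  · intro b _ hb
    rw [Pi.single_eq_of_ne hb]
    simp
  · simp

lemma weight_eq_ofReal (ψ : QVec n a) : weight ψ = ENNReal.ofReal (∑ b, ‖ψ b‖ ^ 2) := by
  rw [weight, ENNReal.ofReal_sum_of_nonneg fun _ _ => sq_nonneg _]
  refine Finset.sum_congr rfl fun b _ => ?_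
  rw [ENNReal.ofReal_pow (norm_nonneg _), ofReal_norm]

lemma weight_ofReal (f : QBasis n a → ℝ) :
    weight (fun b => (f b : ℂ)) = ENNReal.ofReal (∑ b, f b ^ 2) := by
  simp [weight_eq_ofReal]

lemma weight_mulVec (U : Matrix.unitaryGroup (QBasis n a) ℂ) (ψ : QVec n a) :
    weight ((U : Matrix (QBasis n a) (QBasis n a) ℂ) *ᵥ ψ) = weight ψ := by
  have key : ∀ χ : QVec n a, ((∑ b, ‖χ b‖ ^ 2 : ℝ) : ℂ) = star χ ⬝ᵥ χ := fun χ => by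
    simp [dotProduct, Complex.conj_mul']
  have hU : (U : Matrix (QBasis n a) (QBasis n a) ℂ)ᴴ * U = 1 :=
    Matrix.mem_unitaryGroup_iff'.1 U.2
  rw [weight_eq_ofReal, weight_eq_ofReal]
  congr 1
  apply Complex.ofReal_injective
  rw [key, key, Matrix.star_mulVec, Matrix.dotProduct_mulVec, Matrix.vecMul_vecMul, hU,
    Matrix.vecMul_one]

lemma weight_applyOracle (φ : Bits n → ℝ) (y : Bits n) (ψ : QVec n a) :
    weight (applyOracle φ y ψ) = weight ψ := by
  have h : Function.Involutive fun s : QBasis n a => (s.1, s.2.1 ^^ marking φ y s.1, s.2.2) :=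
    fun s => by simp
  exact Equiv.sum_comp h.toPerm fun b => ‖ψ b‖ₑ ^ 2

lemma sum_weight_project {m : ℕ} (r : QBasis n a → Fin m) (ψ : QVec n a) :
    ∑ j, weight (project r j ψ) = weight ψ := by
  unfold weight project
  rw [Finset.sum_comm]
  refine Finset.sum_congr rfl fun b _ => ?_
  rw [Finset.sum_eq_single (r b)]
  · simp
  · intro j _ hj
    simp [hj.symm]
  · simp

lemma inv_mul_sum_const (m : ℕ) (c : ℝ≥0∞) :
    ((m + 1 : ℕ) : ℝ≥0∞)⁻¹ * ∑ _j : Fin (m + 1), c = c := by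
  rw [Finset.sum_const, Finset.card_univ, Fintype.card_fin, nsmul_eq_mul, ← mul_assoc,
    ENNReal.inv_mul_cancel (by simp) (by simp), one_mul]

namespace QProg

/-- The branches of a run carry its whole weight. -/
lemma tsum_prob (φ : Bits n → ℝ) (p : QProg n a α) (ψ : QVec n a) :
    ∑' o, p.prob φ ψ o = weight ψ := by
  induction p generalizing ψ with
  | done o' =>
    rw [tsum_eq_single o']
    · simp [prob]
    · intro o ho
      simp [prob, ho.symm]
  | init p ih => simp [prob, ENNReal.tsum_mul_left, ih, weight_zeroState]
  | gate U p ih => simp [prob, ih, weight_mulVec]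
  | oracle y p ih => simp [prob, ih, weight_applyOracle]
  | measure m r p ih =>
    simp only [prob]
    rw [Summable.tsum_finsetSum fun _ _ => ENNReal.summable]
    simp [ih, sum_weight_project]
  | sample m p ih =>
    simp only [prob]
    rw [ENNReal.tsum_mul_left, Summable.tsum_finsetSum fun _ _ => ENNReal.summable]
    simp only [ih]
    exact inv_mul_sum_const m _

/-- An algorithm whose output distribution and query count do not depend on the state on which it
is run, other than through the probability of the branch. -/
def IsFresh (φ : Bits n → ℝ) (p : QProg n a α) : Prop :=
  ∀ ψ, (∀ o, p.prob φ ψ o = weight ψ * p.outputProb φ o) ∧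
    p.calls φ ψ = weight ψ * p.expectedCalls φ

lemma isFresh_done (φ : Bits n → ℝ) (o : α) : IsFresh φ (done o : QProg n a α) := by
  intro ψ
  refine ⟨fun o' => ?_, by simp [calls, expectedCalls]⟩
  by_cases h : o = o' <;> simp [prob, outputProb, weight_zeroState, h]

lemma isFresh_init (φ : Bits n → ℝ) (p : QProg n a α) : IsFresh φ (init p) := by
  intro ψ
  simp [prob, calls, outputProb, expectedCalls, weight_zeroState]

lemma prob_bind (φ : Bits n → ℝ) (p : QProg n a α) (q : α → QProg n a β)
    (hq : ∀ o, IsFresh φ (q o)) (ψ : QVec n a) (o : β) :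
    (p.bind q).prob φ ψ o = ∑' i, p.prob φ ψ i * (q i).outputProb φ o := by
  induction p generalizing ψ with
  | done o' =>
    rw [tsum_eq_single o']
    · simp [prob, QProg.bind, (hq o' ψ).1]
    · intro i hi
      simp [prob, hi.symm]
  | init p ih => simp [prob, QProg.bind, ih, mul_assoc, ENNReal.tsum_mul_left]
  | gate U p ih => simp [prob, QProg.bind, ih]
  | oracle y p ih => simp [prob, QProg.bind, ih]
  | measure m r p ih =>
    simp only [prob, QProg.bind, ih, Finset.sum_mul]
    rw [Summable.tsum_finsetSum fun _ _ => ENNReal.summable]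
  | sample m p ih =>
    simp only [prob, QProg.bind, ih, Finset.sum_mul, mul_assoc]
    rw [ENNReal.tsum_mul_left, Summable.tsum_finsetSum fun _ _ => ENNReal.summable]

lemma calls_bind (φ : Bits n → ℝ) (p : QProg n a α) (q : α → QProg n a β)
    (hq : ∀ o, IsFresh φ (q o)) (ψ : QVec n a) :
    (p.bind q).calls φ ψ = p.calls φ ψ + ∑' i, p.prob φ ψ i * (q i).expectedCalls φ := by
  induction p generalizing ψ with
  | done o' =>
    rw [tsum_eq_single o']
    · simp [prob, calls, QProg.bind, (hq o' ψ).2]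
    · intro i hi
      simp [prob, hi.symm]
  | init p ih =>
    simp [prob, calls, QProg.bind, ih, mul_assoc, ENNReal.tsum_mul_left, mul_add]
  | gate U p ih => simp [prob, calls, QProg.bind, ih]
  | oracle y p ih => simp [prob, calls, QProg.bind, ih, add_assoc]
  | measure m r p ih =>
    simp only [prob, calls, QProg.bind, ih, Finset.sum_mul]
    rw [Summable.tsum_finsetSum fun _ _ => ENNReal.summable, Finset.sum_add_distrib]
  | sample m p ih =>
    simp only [prob, calls, QProg.bind, ih, Finset.sum_mul, mul_assoc]
    rw [ENNReal.tsum_mul_left, Summable.tsum_finsetSum fun _ _ => ENNReal.summable,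
      Finset.sum_add_distrib, mul_add]

/-- The distribution of the output of an algorithm started in `|0…0⟩`. -/
def outputPMF (φ : Bits n → ℝ) (p : QProg n a α) : PMF α :=
  ⟨p.outputProb φ, by
    have h := ENNReal.summable.hasSum (f := p.outputProb φ)
    have h' : ∑' o, p.outputProb φ o = 1 := by
      simp only [outputProb]
      rw [tsum_prob, weight_zeroState]
    rwa [h'] at h⟩

lemma outputPMF_apply (φ : Bits n → ℝ) (p : QProg n a α) (o : α) :
    p.outputPMF φ o = p.outputProb φ o := rfl

end QProg

end Semantics

/-! ### Real reflections and state preparation -/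

section Reflection

variable {ι : Type} [Fintype ι] [DecidableEq ι]

/-- The reflection `2 w wᵀ / ‖w‖² - 1` about the line spanned by a real vector `w`. For `w = 0` this
is `-1`, by the convention on division by zero, which is unitary as well. -/
def reflection (w : ι → ℝ) : Matrix.unitaryGroup ι ℂ :=
  ⟨Matrix.of fun b c =>
    ((2 / (∑ i, w i ^ 2) * (w b * w c) - if b = c then 1 else 0 : ℝ) : ℂ), by
    rw [Matrix.mem_unitaryGroup_iff]
    ext b c
    rw [Matrix.mul_apply]
    simp only [Matrix.star_apply, Matrix.of_apply, RCLike.star_def, Complex.conj_ofReal]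
    have hκ : (2 / (∑ i, w i ^ 2)) * (2 / (∑ i, w i ^ 2)) * (∑ i, w i ^ 2)
        = 2 * (2 / (∑ i, w i ^ 2)) := by
      by_cases h : ∑ i, w i ^ 2 = 0
      · simp [h]
      · field_simp
    set κ := 2 / (∑ i, w i ^ 2) with hκd
    have : ∀ i, (κ * (w b * w i) - if b = i then 1 else 0) *
        (κ * (w c * w i) - if c = i then 1 else 0)
        = κ * κ * (w b * w c) * w i ^ 2 - (if b = i then κ * (w c * w i) else 0)
          - (if c = i then κ * (w b * w i) else 0)
          + (if b = i then (if c = i then 1 else 0) else 0) := fun i => by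
      split_ifs <;> ring
    have hs : ∑ i, (κ * (w b * w i) - if b = i then 1 else 0) *
        (κ * (w c * w i) - if c = i then 1 else 0) = if b = c then 1 else 0 := by
      simp_rw [this]
      rw [Finset.sum_add_distrib, Finset.sum_sub_distrib, Finset.sum_sub_distrib,
        ← Finset.mul_sum, Finset.sum_ite_eq, Finset.sum_ite_eq, Finset.sum_ite_eq]
      simp only [Finset.mem_univ, if_true]
      rw [show (if c = b then (1 : ℝ) else 0) = if b = c then 1 else 0 by simp [eq_comm]]
      linear_combination (w b * w c) * hκ
    rw [Matrix.one_apply]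
    calc _ = ((∑ i, (κ * (w b * w i) - if b = i then 1 else 0) *
        (κ * (w c * w i) - if c = i then 1 else 0) : ℝ) : ℂ) := by push_cast; rfl
      _ = _ := by rw [hs]; split_ifs <;> simp⟩

lemma reflection_mulVec (w f : ι → ℝ) :
    (reflection w : Matrix ι ι ℂ) *ᵥ (fun b => (f b : ℂ))
      = fun b => ((2 / (∑ i, w i ^ 2) * (∑ i, w i * f i) * w b - f b : ℝ) : ℂ) := by
  ext b
  have : ∑ c, (2 / (∑ i, w i ^ 2) * (w b * w c) - if b = c then 1 else 0) * f c
      = 2 / (∑ i, w i ^ 2) * (∑ i, w i * f i) * w b - f b := by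
    simp only [sub_mul, ite_mul, one_mul, zero_mul]
    rw [Finset.sum_sub_distrib, Finset.sum_ite_eq, Finset.mul_sum, Finset.sum_mul]
    simp only [Finset.mem_univ, if_true]
    congr 1
    exact Finset.sum_congr rfl fun c _ => by ring
  rw [← this]
  simp [Matrix.mulVec, dotProduct, reflection]

end Reflection

/-- A unitary that maps `|0…0⟩` to the real unit vector `v`, provided that `v` has a non-negative
first coordinate: the reflection about the bisector of the two. -/
def prepare {n a : ℕ} (v : QBasis n a → ℝ) : Matrix.unitaryGroup (QBasis n a) ℂ :=
  reflection fun b => (Pi.single (fun _ => false, false, fun _ => false) 1 : QBasis n a → ℝ) b + v b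

lemma prepare_mulVec {n a : ℕ} (v : QBasis n a → ℝ) (hv : ∑ b, v b ^ 2 = 1)
    (h0 : 0 ≤ v (fun _ => false, false, fun _ => false)) :
    (prepare v : Matrix (QBasis n a) (QBasis n a) ℂ) *ᵥ zeroState n a = fun b => (v b : ℂ) := by
  set z : QBasis n a := (fun _ => false, false, fun _ => false)
  have hz : zeroState n a = fun b => (((Pi.single z 1 : QBasis n a → ℝ) b : ℝ) : ℂ) := by
    ext b
    by_cases h : b = z
    · subst h; simp [zeroState, z]
    · simp only [zeroState]
      rw [Pi.single_eq_of_ne h, Pi.single_eq_of_ne h]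
      simp
  rw [hz, prepare, reflection_mulVec]
  have h1 : ∑ b, ((Pi.single z 1 : QBasis n a → ℝ) b + v b) * (Pi.single z 1 : QBasis n a → ℝ) b
      = 1 + v z := by
    rw [Finset.sum_eq_single z]
    · simp
    · intro b _ hb
      simp [Pi.single_eq_of_ne hb]
    · simp
  have h2 : ∑ b, ((Pi.single z 1 : QBasis n a → ℝ) b + v b) ^ 2 = 2 * (1 + v z) := by
    have : ∀ b, ((Pi.single z 1 : QBasis n a → ℝ) b + v b) ^ 2
        = (if b = z then 1 + 2 * v b else 0) + v b ^ 2 := fun b => by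
      by_cases h : b = z
      · subst h; simp; ring
      · simp [h]
    simp_rw [this]
    rw [Finset.sum_add_distrib, hv, Finset.sum_ite_eq']
    simp; ring
  ext b
  rw [h1, h2]
  have : (1 + v z) ≠ 0 := by positivity
  congr 1
  field_simp
  ring

/-! ### Grover iterations -/

section Grover

variable {n : ℕ} {φ : Bits n → ℝ} {A : Finset (Bits n)} {x : Bits n}

lemma sum_qbasis_zero (f : QBasis n 0 → ℝ) (g : Bits n → Bool → ℝ)
    (h : ∀ b, f b = g b.1 b.2.1) : ∑ b, f b = ∑ y, (g y true + g y false) := by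
  rw [Fintype.sum_prod_type]
  refine Finset.sum_congr rfl fun y _ => ?_
  rw [Fintype.sum_prod_type, Fintype.sum_bool]
  simp [h]

/-- The uniform superposition of the `|y⟩|0⟩` with `y ∈ A`. The target qubit is `|0⟩` rather than
`|-⟩`, so that an oracle application changes the sign of the `|-⟩`-half of each marked string
only; the part that gets amplified then has weight at most `1/2`. -/
def searchVec (A : Finset (Bits n)) : QBasis n 0 → ℝ :=
  fun b => if b.1 ∈ A then (if b.2.1 then 0 else (√(A.card : ℝ))⁻¹) else 0

lemma sum_searchVec_sq (hA : A.Nonempty) : ∑ b, searchVec A b ^ 2 = 1 := by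
  rw [sum_qbasis_zero (fun b => searchVec A b ^ 2)
    (fun y b => (if y ∈ A then (if b then 0 else (√(A.card : ℝ))⁻¹) else 0) ^ 2)
    (fun b => rfl)]
  have : (A.card : ℝ) ≠ 0 := by exact_mod_cast hA.card_pos.ne'
  simp [Finset.sum_ite_mem, this]

lemma prepare_searchVec (hA : A.Nonempty) :
    (prepare (searchVec A) : Matrix (QBasis n 0) (QBasis n 0) ℂ) *ᵥ zeroState n 0
      = fun b => (searchVec A b : ℂ) := by
  refine prepare_mulVec _ (sum_searchVec_sq hA) ?_
  unfold searchVec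
  positivity

/-- One Grover iteration: the oracle, then the reflection about `searchVec A`. -/
def groverStep (φ : Bits n → ℝ) (A : Finset (Bits n)) (x : Bits n) (ψ : QVec n 0) : QVec n 0 :=
  (reflection (searchVec A) : Matrix (QBasis n 0) (QBasis n 0) ℂ) *ᵥ applyOracle φ x ψ

/-- The state after `j` Grover iterations. -/
def groverState (φ : Bits n → ℝ) (A : Finset (Bits n)) (x : Bits n) (j : ℕ) : QVec n 0 :=
  (groverStep φ A x)^[j] fun b => (searchVec A b : ℂ)

lemma weight_groverState (hA : A.Nonempty) (j : ℕ) : weight (groverState φ A x j) = 1 := by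
  induction j with
  | zero => simp [groverState, weight_ofReal, sum_searchVec_sq hA]
  | succ j ih =>
    rw [groverState, Function.iterate_succ_apply', groverStep, weight_mulVec, weight_applyOracle]
    exact ih

/-- The vector with amplitudes `p` and `q` at `|y⟩|0⟩` and `|y⟩|1⟩` for marked `y ∈ A`, and with
amplitudes `r` and `0` there for unmarked `y ∈ A`. -/
def markedVec (φ : Bits n → ℝ) (A : Finset (Bits n)) (x : Bits n) (p q r : ℝ) : QBasis n 0 → ℝ :=
  fun b => if b.1 ∈ A then
    (if marking φ x b.1 then (if b.2.1 then q else p) else (if b.2.1 then 0 else r)) else 0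

lemma markedVec_congr {p q r p' q' r' : ℝ} (hp : p = p') (hq : q = q') (hr : r = r') :
    (fun b => (markedVec φ A x p q r b : ℂ)) = fun b => (markedVec φ A x p' q' r' b : ℂ) := by
  rw [hp, hq, hr]

lemma searchVec_eq_markedVec :
    searchVec A = markedVec φ A x (√(A.card : ℝ))⁻¹ 0 (√(A.card : ℝ))⁻¹ := by
  ext ⟨y, b, w⟩
  simp [searchVec, markedVec]

lemma applyOracle_markedVec (p q r : ℝ) :
    applyOracle φ x (fun b => (markedVec φ A x p q r b : ℂ))
      = fun b => (markedVec φ A x q p r b : ℂ) := by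
  ext ⟨y, b, w⟩
  cases b <;> cases h : marking φ x y <;> simp [applyOracle, markedVec, h]

lemma groverStep_markedVec (hA : A.Nonempty) (p q r S : ℝ)
    (hS : ((A.filter fun y => marking φ x y = true).card : ℝ) = 2 * S ^ 2 * A.card) :
    groverStep φ A x (fun b => (markedVec φ A x p q r b : ℂ))
      = fun b => (markedVec φ A x (2 * (2 * S ^ 2 * q + (1 - 2 * S ^ 2) * r) - q) (-p)
          (2 * (2 * S ^ 2 * q + (1 - 2 * S ^ 2) * r) - r) b : ℂ) := by
  have hN : (0 : ℝ) < A.card := by exact_mod_cast hA.card_pos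
  have hsum : ∑ b, searchVec A b * markedVec φ A x q p r b
      = (√(A.card : ℝ))⁻¹ * ((2 * S ^ 2 * q + (1 - 2 * S ^ 2) * r) * A.card) := by
    rw [sum_qbasis_zero (fun b => searchVec A b * markedVec φ A x q p r b)
      (fun y b => (if y ∈ A then (if b then 0 else (√(A.card : ℝ))⁻¹) else 0) *
      (if y ∈ A then (if marking φ x y then (if b then p else q) else (if b then 0 else r)) else 0))
      (fun b => rfl)]
    have h1 : ∀ y : Bits n,
        (if y ∈ A then (if true then 0 else (√(A.card : ℝ))⁻¹) else 0) *
        (if y ∈ A then (if marking φ x y then (if true then p else q) else (if true then 0 else r))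
          else 0) +
        (if y ∈ A then (if false then 0 else (√(A.card : ℝ))⁻¹) else 0) *
        (if y ∈ A then (if marking φ x y then (if false then p else q)
          else (if false then 0 else r)) else 0)
        = if y ∈ A then (√(A.card : ℝ))⁻¹ * (r + if marking φ x y = true then q - r else 0)
          else 0 := fun y => by
      by_cases h : y ∈ A <;> cases h' : marking φ x y <;> simp [h]
    have h2 := Finset.sum_congr (rfl : (Finset.univ : Finset (Bits n)) = _) fun y _ => h1 y
    rw [Finset.sum_ite_mem, Finset.univ_inter, ← Finset.mul_sum,
      Finset.sum_add_distrib (f := fun _ => r), Finset.sum_const, ← Finset.sum_filter,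
      Finset.sum_const, nsmul_eq_mul, nsmul_eq_mul, hS] at h2
    refine h2.trans ?_
    ring
  rw [groverStep, applyOracle_markedVec, reflection_mulVec, sum_searchVec_sq hA, hsum]
  ext ⟨y, b, w⟩
  congr 1
  have hα : (√(A.card : ℝ))⁻¹ * (√(A.card : ℝ))⁻¹ * A.card = 1 := by
    rw [← mul_inv, Real.mul_self_sqrt hN.le, inv_mul_cancel₀ hN.ne']
  by_cases h : y ∈ A
  · cases b <;> cases h' : marking φ x y <;>
      simp only [searchVec, markedVec, h, h', if_true, if_false, Bool.false_eq_true]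
    · linear_combination 2 * (2 * S ^ 2 * q + (1 - 2 * S ^ 2) * r) * hα
    · linear_combination 2 * (2 * S ^ 2 * q + (1 - 2 * S ^ 2) * r) * hα
    · ring
    · ring
  · simp [searchVec, markedVec, h]

/-- With `θ` the angle for which `sin² θ` is half the marked fraction, `j` Grover iterations rotate
the amplitudes to the angle `(2 j + 1) θ`. -/
lemma groverState_eq (hA : A.Nonempty) (θ : ℝ) (hs : Real.sin θ ≠ 0) (hc : Real.cos θ ≠ 0)
    (hS : ((A.filter fun y => marking φ x y = true).card : ℝ) = 2 * Real.sin θ ^ 2 * A.card)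
    (j : ℕ) :
    groverState φ A x j = fun b => (markedVec φ A x
      ((√(A.card : ℝ))⁻¹ * (Real.sin ((2 * j + 1) * θ) / (2 * Real.sin θ)
        + Real.cos ((2 * j + 1) * θ) / (2 * Real.cos θ)))
      ((√(A.card : ℝ))⁻¹ * (-(Real.sin ((2 * j + 1) * θ) / (2 * Real.sin θ))
        + Real.cos ((2 * j + 1) * θ) / (2 * Real.cos θ)))
      ((√(A.card : ℝ))⁻¹ * (Real.cos ((2 * j + 1) * θ) / Real.cos θ)) b : ℂ) := by
  induction j with
  | zero =>
    rw [groverState, Function.iterate_zero, id, searchVec_eq_markedVec (φ := φ) (x := x)]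
    have h1 : Real.sin θ / (2 * Real.sin θ) = 1 / 2 := by field_simp
    have h2 : Real.cos θ / (2 * Real.cos θ) = 1 / 2 := by field_simp
    refine markedVec_congr ?_ ?_ ?_ <;>
      simp only [Nat.cast_zero, mul_zero, zero_add, one_mul, h1, h2, div_self hc] <;> ring
  | succ j ih =>
    rw [groverState, Function.iterate_succ_apply', ← groverState, ih,
      groverStep_markedVec hA _ _ _ _ hS]
    have hang : (2 * ((j + 1 : ℕ) : ℝ) + 1) * θ = (2 * j + 1) * θ + 2 * θ := by push_cast; ring
    have hsq := Real.sin_sq_add_cos_sq θ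
    rw [hang, Real.sin_add, Real.cos_add, Real.sin_two_mul, Real.cos_two_mul]
    obtain ⟨u, hu⟩ : ∃ u, u = Real.sin ((2 * j + 1) * θ) / (2 * Real.sin θ) := ⟨_, rfl⟩
    obtain ⟨v, hv⟩ : ∃ v, v = Real.cos ((2 * j + 1) * θ) / (2 * Real.cos θ) := ⟨_, rfl⟩
    have hB : Real.sin ((2 * j + 1) * θ) = 2 * Real.sin θ * u := by rw [hu]; field_simp
    have hD : Real.cos ((2 * j + 1) * θ) = 2 * Real.cos θ * v := by rw [hv]; field_simp
    rw [hB, hD]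
    set s := Real.sin θ
    set c := Real.cos θ
    have e1 : 2 * s * u / (2 * s) = u := by field_simp
    have e2 : 2 * c * v / (2 * c) = v := by field_simp
    have e3 : 2 * c * v / c = 2 * v := by field_simp
    have e4 : (2 * s * u * (2 * c ^ 2 - 1) + 2 * c * v * (2 * s * c)) / (2 * s)
        = u * (2 * c ^ 2 - 1) + 2 * c ^ 2 * v := by field_simp
    have e5 : (2 * c * v * (2 * c ^ 2 - 1) - 2 * s * u * (2 * s * c)) / (2 * c)
        = v * (2 * c ^ 2 - 1) - 2 * s ^ 2 * u := by field_simp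
    have e6 : (2 * c * v * (2 * c ^ 2 - 1) - 2 * s * u * (2 * s * c)) / c
        = 2 * (v * (2 * c ^ 2 - 1) - 2 * s ^ 2 * u) := by field_simp
    rw [e1, e2, e3, e4, e5, e6]
    refine markedVec_congr ?_ ?_ ?_
    · linear_combination (-(√(A.card : ℝ))⁻¹ * (2 * u + 4 * v)) * hsq
    · linear_combination (2 * (√(A.card : ℝ))⁻¹ * u) * hsq
    · linear_combination (-4 * (√(A.card : ℝ))⁻¹ * v) * hsq

end Grover

/-! ### Averaging over the number of Grover iterations -/

lemma sum_sin_sq_odd (θ : ℝ) (M : ℕ) :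
    4 * Real.sin (2 * θ) * ∑ j ∈ Finset.range M, Real.sin ((2 * j + 1) * θ) ^ 2
      = 2 * M * Real.sin (2 * θ) - Real.sin (4 * M * θ) := by
  induction M with
  | zero => simp
  | succ M ih =>
    rw [Finset.sum_range_succ, mul_add, ih]
    have h1 : 4 * (M : ℝ) * θ = 2 * ((2 * M + 1) * θ) - 2 * θ := by ring
    have h2 : 4 * ((M + 1 : ℕ) : ℝ) * θ = 2 * ((2 * M + 1) * θ) + 2 * θ := by push_cast; ring
    rw [h1, h2, Real.sin_add, Real.sin_sub, Real.cos_two_mul ((2 * (M : ℝ) + 1) * θ)]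
    have := Real.sin_sq_add_cos_sq ((2 * (M : ℝ) + 1) * θ)
    push_cast
    linear_combination 4 * Real.sin (2 * θ) * this

lemma quarter_le_sum_sin_sq (θ : ℝ) (M : ℕ) (h0 : 0 < Real.sin (2 * θ))
    (hM : 1 ≤ M * Real.sin (2 * θ)) :
    (M : ℝ) / 4 ≤ ∑ j ∈ Finset.range M, Real.sin ((2 * j + 1) * θ) ^ 2 := by
  have h := sum_sin_sq_odd θ M
  have h1 := Real.sin_le_one (4 * M * θ)
  have : 4 * Real.sin (2 * θ) * ((M : ℝ) / 4)
      ≤ 4 * Real.sin (2 * θ) * ∑ j ∈ Finset.range M, Real.sin ((2 * j + 1) * θ) ^ 2 := by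
    rw [h]; linarith
  exact le_of_mul_le_mul_left this (by positivity)

section Trial

variable {n : ℕ} {φ : Bits n → ℝ} {A : Finset (Bits n)} {x : Bits n}

/-- The elements of `A` that the oracle `O_{f_x}` marks. -/
def marked (φ : Bits n → ℝ) (A : Finset (Bits n)) (x : Bits n) : Finset (Bits n) :=
  A.filter fun y => marking φ x y = true

/-- The argument register, read as a number. -/
def argReg {n : ℕ} (b : QBasis n 0) : Fin (Fintype.card (Bits n)) := Fintype.equivFin (Bits n) b.1

/-- The probability that measuring the argument register after `j` Grover iterations yields `y`. -/
def hitProb (φ : Bits n → ℝ) (A : Finset (Bits n)) (x : Bits n) (j : ℕ) (y : Bits n) : ℝ≥0∞ :=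
  weight (project argReg (Fintype.equivFin (Bits n) y) (groverState φ A x j))

/-- The probability of measuring `y` when the number of Grover iterations is drawn uniformly from
`{0, …, m}`. -/
def trialProb (φ : Bits n → ℝ) (A : Finset (Bits n)) (x : Bits n) (m : ℕ) (y : Bits n) : ℝ≥0∞ :=
  ((m + 1 : ℕ) : ℝ≥0∞)⁻¹ * ∑ j : Fin (m + 1), hitProb φ A x j y

/-- The probability that such a measurement yields no marked string. -/
def missProb (φ : Bits n → ℝ) (A : Finset (Bits n)) (x : Bits n) (m : ℕ) : ℝ≥0∞ :=
  ∑ y ∈ (marked φ A x)ᶜ, trialProb φ A x m y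

lemma sum_hitProb (hA : A.Nonempty) (j : ℕ) : ∑ y, hitProb φ A x j y = 1 := by
  unfold hitProb
  rw [Equiv.sum_comp (Fintype.equivFin (Bits n))
    (fun i => weight (project argReg i (groverState φ A x j))), sum_weight_project,
    weight_groverState hA]

lemma sum_trialProb (hA : A.Nonempty) (m : ℕ) : ∑ y, trialProb φ A x m y = 1 := by
  unfold trialProb
  rw [← Finset.mul_sum, Finset.sum_comm]
  simp_rw [sum_hitProb hA]
  exact inv_mul_sum_const m 1

lemma sum_marked_add_missProb (hA : A.Nonempty) (m : ℕ) :
    ∑ y ∈ marked φ A x, trialProb φ A x m y + missProb φ A x m = 1 := by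
  rw [missProb, Finset.sum_add_sum_compl, sum_trialProb hA]

lemma weight_project_markedVec {y : Bits n} (hy : y ∈ marked φ A x) (p q r : ℝ) :
    weight (project argReg (Fintype.equivFin (Bits n) y)
      (fun b => (markedVec φ A x p q r b : ℂ))) = ENNReal.ofReal (p ^ 2 + q ^ 2) := by
  have h : project argReg (Fintype.equivFin (Bits n) y) (fun b => (markedVec φ A x p q r b : ℂ))
      = fun b => ((if b.1 = y then (if b.2.1 then q else p) else 0 : ℝ) : ℂ) := by
    obtain ⟨h1, h2⟩ := Finset.mem_filter.1 hy
    ext ⟨z, b, w⟩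
    by_cases hz : z = y
    · subst hz
      simp [project, argReg, markedVec, h1, h2]
    · simp [project, argReg, hz]
  rw [h, weight_ofReal, sum_qbasis_zero _
    (fun z b => (if z = y then (if b then q else p) else 0) ^ 2) (fun b => rfl)]
  rw [Finset.sum_eq_single y]
  · simp [add_comm]
  · intro z _ hz
    simp [hz]
  · simp

/-- The Grover angle of a search for `t` marked strings among `N`. -/
lemma exists_grover_angle {t N : ℕ} (ht : 0 < t) (htN : t ≤ N) :
    ∃ θ : ℝ, 0 < Real.sin θ ∧ 0 < Real.cos θ ∧ (t : ℝ) = 2 * Real.sin θ ^ 2 * N ∧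
      (t : ℝ) ≤ Real.sin (2 * θ) ^ 2 * N := by
  have ht' : (0 : ℝ) < t := by exact_mod_cast ht
  have htN' : (t : ℝ) ≤ N := by exact_mod_cast htN
  have hN : (0 : ℝ) < N := ht'.trans_le htN'
  have hq : (t : ℝ) / (2 * N) ≤ 1 / 2 := by
    rw [div_le_div_iff₀ (by positivity) (by norm_num)]; linarith
  have hq0 : 0 < (t : ℝ) / (2 * N) := by positivity
  have hs : Real.sin (Real.arcsin √((t : ℝ) / (2 * N))) = √((t : ℝ) / (2 * N)) :=
    Real.sin_arcsin (by linarith [Real.sqrt_nonneg ((t : ℝ) / (2 * N))])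
      (Real.sqrt_le_one.2 (by linarith))
  have hc : Real.cos (Real.arcsin √((t : ℝ) / (2 * N))) = √(1 - (t : ℝ) / (2 * N)) := by
    rw [Real.cos_arcsin, Real.sq_sqrt hq0.le]
  refine ⟨Real.arcsin √((t : ℝ) / (2 * N)), ?_, ?_, ?_, ?_⟩
  · rw [hs]; exact Real.sqrt_pos.2 hq0
  · rw [hc]; exact Real.sqrt_pos.2 (by linarith)
  · rw [hs, Real.sq_sqrt hq0.le]; field_simp
  · rw [Real.sin_two_mul, hs, hc, mul_pow, mul_pow, Real.sq_sqrt hq0.le,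
      Real.sq_sqrt (by linarith)]
    have : (t : ℝ) = 2 * ((t : ℝ) / (2 * N)) * N := by field_simp
    calc (t : ℝ) = 2 * ((t : ℝ) / (2 * N)) * N := this
      _ ≤ 2 ^ 2 * ((t : ℝ) / (2 * N)) * (1 - (t : ℝ) / (2 * N)) * N := by
        have h1 : 0 ≤ (t : ℝ) / (2 * N) * (1 / 2 - (t : ℝ) / (2 * N)) :=
          mul_nonneg hq0.le (by linarith)
        refine mul_le_mul_of_nonneg_right ?_ hN.le
        linarith

lemma marked_angle (h : (marked φ A x).Nonempty) :
    ∃ θ : ℝ, 0 < Real.sin θ ∧ 0 < Real.cos θ ∧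
      ((marked φ A x).card : ℝ) = 2 * Real.sin θ ^ 2 * A.card ∧
      ((marked φ A x).card : ℝ) ≤ Real.sin (2 * θ) ^ 2 * A.card :=
  exists_grover_angle h.card_pos (Finset.card_le_card (Finset.filter_subset _ _))

/-- The amplitudes of a search do not distinguish between marked strings. -/
lemma trialProb_congr {y z : Bits n} (hy : y ∈ marked φ A x) (hz : z ∈ marked φ A x) (m : ℕ) :
    trialProb φ A x m y = trialProb φ A x m z := by
  obtain ⟨θ, hs, hc, hS, -⟩ := marked_angle ⟨y, hy⟩
  have hA : A.Nonempty := ⟨y, (Finset.mem_filter.1 hy).1⟩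
  unfold trialProb hitProb
  simp_rw [groverState_eq hA θ hs.ne' hc.ne' hS, weight_project_markedVec hy,
    weight_project_markedVec hz]

lemma sin_sq_le_sum_hitProb (h : (marked φ A x).Nonempty) (θ : ℝ) (hs : 0 < Real.sin θ)
    (hc : 0 < Real.cos θ) (hS : ((marked φ A x).card : ℝ) = 2 * Real.sin θ ^ 2 * A.card) (j : ℕ) :
    ENNReal.ofReal (Real.sin ((2 * j + 1) * θ) ^ 2) ≤ ∑ y ∈ marked φ A x, hitProb φ A x j y := by
  obtain ⟨y, hy⟩ := h
  have hA : A.Nonempty := ⟨y, (Finset.mem_filter.1 hy).1⟩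
  have hN : (0 : ℝ) < A.card := by exact_mod_cast hA.card_pos
  unfold hitProb
  rw [Finset.sum_congr rfl fun y hy => by
    rw [groverState_eq hA θ hs.ne' hc.ne' hS, weight_project_markedVec hy]]
  rw [Finset.sum_const, ← ENNReal.ofReal_nsmul, nsmul_eq_mul, hS]
  refine ENNReal.ofReal_le_ofReal ?_
  set u := Real.sin ((2 * j + 1) * θ) with hu
  set v := Real.cos ((2 * j + 1) * θ) / (2 * Real.cos θ)
  have h1 : (√(A.card : ℝ))⁻¹ ^ 2 * A.card = 1 := by
    rw [inv_pow, Real.sq_sqrt hN.le, inv_mul_cancel₀ hN.ne']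
  have h2 : Real.sin θ ^ 2 * (u / (2 * Real.sin θ)) ^ 2 * 4 = u ^ 2 := by
    field_simp; norm_num
  have h3 : 2 * Real.sin θ ^ 2 * A.card * (((√(A.card : ℝ))⁻¹ * (u / (2 * Real.sin θ) + v)) ^ 2
      + ((√(A.card : ℝ))⁻¹ * (-(u / (2 * Real.sin θ)) + v)) ^ 2)
      = u ^ 2 + 4 * Real.sin θ ^ 2 * v ^ 2 := by
    linear_combination (4 * Real.sin θ ^ 2 * ((u / (2 * Real.sin θ)) ^ 2 + v ^ 2)) * h1 + h2
  rw [h3]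
  have : 0 ≤ 4 * Real.sin θ ^ 2 * v ^ 2 := by positivity
  linarith

/-- A trial that draws from at least `√(N/t)` numbers of iterations fails with probability at most
`3/4`. -/
lemma missProb_le (h : (marked φ A x).Nonempty) (m : ℕ)
    (hm : (A.card : ℝ) ≤ (m + 1 : ℝ) ^ 2 * (marked φ A x).card) :
    (missProb φ A x m).toReal ≤ 3 / 4 := by
  obtain ⟨θ, hs, hc, hS, hS'⟩ := marked_angle h
  have hA : A.Nonempty := h.mono (Finset.filter_subset _ _)
  have hN : (0 : ℝ) < A.card := by exact_mod_cast hA.card_pos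
  have h0 : 0 < Real.sin (2 * θ) := by rw [Real.sin_two_mul]; positivity
  have hM : 1 ≤ ((m + 1 : ℕ) : ℝ) * Real.sin (2 * θ) := by
    push_cast
    have h1 : (A.card : ℝ) * 1 ≤ A.card * ((m + 1) * Real.sin (2 * θ)) ^ 2 := by
      nlinarith [mul_le_mul_of_nonneg_left hS' (sq_nonneg (m + 1 : ℝ))]
    have h2 := le_of_mul_le_mul_left h1 hN
    have h3 : 0 ≤ ((m : ℝ) + 1) * Real.sin (2 * θ) := by positivity
    nlinarith
  have hsum := quarter_le_sum_sin_sq θ (m + 1) h0 hM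
  have hq : ENNReal.ofReal (1 / 4) ≤ ∑ y ∈ marked φ A x, trialProb φ A x m y := by
    unfold trialProb
    rw [← Finset.mul_sum, Finset.sum_comm]
    calc ENNReal.ofReal (1 / 4)
        = ((m + 1 : ℕ) : ℝ≥0∞)⁻¹ * ENNReal.ofReal (((m + 1 : ℕ) : ℝ) / 4) := by
          rw [← ENNReal.ofReal_natCast, ← ENNReal.ofReal_inv_of_pos (by positivity),
            ← ENNReal.ofReal_mul (by positivity)]
          congr 1
          field_simp
      _ ≤ ((m + 1 : ℕ) : ℝ≥0∞)⁻¹ * ∑ j : Fin (m + 1),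
            ENNReal.ofReal (Real.sin ((2 * (j : ℕ) + 1) * θ) ^ 2) := by
          gcongr
          rw [← ENNReal.ofReal_sum_of_nonneg fun _ _ => sq_nonneg _,
            Fin.sum_univ_eq_sum_range (fun j : ℕ => Real.sin ((2 * (j : ℝ) + 1) * θ) ^ 2)]
          exact ENNReal.ofReal_le_ofReal hsum
      _ ≤ _ := by
          gcongr with j
          exact sin_sq_le_sum_hitProb h θ hs hc hS j
  have htot := sum_marked_add_missProb (φ := φ) (x := x) hA m
  have hne : ∑ y ∈ marked φ A x, trialProb φ A x m y ≠ ∞ := fun h => by simp [h] at htot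
  have hne' : missProb φ A x m ≠ ∞ := fun h => by simp [h] at htot
  have h1 := congrArg ENNReal.toReal htot
  rw [ENNReal.toReal_add hne hne', ENNReal.toReal_one] at h1
  have h2 := (ENNReal.ofReal_le_iff_le_toReal hne).1 hq
  linarith

end Trial

/-! ### Quantum search with a schedule of trials -/

section Search

variable {n : ℕ} {φ : Bits n → ℝ} {A : Finset (Bits n)} {x : Bits n}

open QProg

/-- Test with a single query whether `O_{f_x}` marks `y`; output `y` if so, and otherwise run
`p`. -/
def verify (x y : Bits n) (p : QProg n 0 (Option (Bits n))) : QProg n 0 (Option (Bits n)) :=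
  .init <| .gate (prepare (Pi.single (y, false, fun _ => false) 1)) <| .oracle x <|
    .measure 2 (fun b => if b.2.1 then 1 else 0) fun i => if i = 1 then .done (some y) else p

/-- Apply `j` Grover iterations, then run `p`. -/
def groverIterate (A : Finset (Bits n)) (x : Bits n) :
    ℕ → QProg n 0 (Option (Bits n)) → QProg n 0 (Option (Bits n))
  | 0, p => p
  | j + 1, p => .oracle x (.gate (reflection (searchVec A)) (groverIterate A x j p))

/-- One trial of a search in `A`: apply a uniformly random number `j ≤ m` of Grover iterations,
measure, and verify the result. If the trial fails, continue with `p`. -/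
def trial (A : Finset (Bits n)) (x : Bits n) (m : ℕ) (p : QProg n 0 (Option (Bits n))) :
    QProg n 0 (Option (Bits n)) :=
  .init <| .gate (prepare (searchVec A)) <| .sample m fun j => groverIterate A x j <|
    .measure _ argReg fun i => if (Fintype.equivFin (Bits n)).symm i ∈ A
      then verify x ((Fintype.equivFin (Bits n)).symm i) p else p

/-- Trials with the parameters from a list, until one of them succeeds. -/
def search (A : Finset (Bits n)) (x : Bits n) : List ℕ → QProg n 0 (Option (Bits n))
  | [] => .done none
  | m :: l => trial A x m (search A x l)

lemma isFresh_verify (y : Bits n) (p : QProg n 0 (Option (Bits n))) :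
    IsFresh φ (verify x y p) := isFresh_init _ _

lemma isFresh_search (l : List ℕ) : IsFresh φ (search A x l) := by
  cases l with
  | nil => exact isFresh_done _ _
  | cons m l => exact isFresh_init _ _

/-- The state of `verify` before its measurement. -/
lemma verify_state (y : Bits n) :
    applyOracle φ x ((prepare (n := n) (a := 0) (Pi.single (y, false, fun _ => false) 1) :
      Matrix (QBasis n 0) (QBasis n 0) ℂ) *ᵥ zeroState n 0)
      = Pi.single (y, marking φ x y, fun _ => false) 1 := by
  rw [prepare_mulVec]
  · ext ⟨z, b, w⟩
    obtain rfl : w = fun _ => false := Subsingleton.elim _ _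
    by_cases h : z = y
    · subst h
      cases b <;> cases h : marking φ x z <;> simp [applyOracle, h]
    · simp [applyOracle, h]
  · simp [Pi.single_apply]
  · rw [Pi.single_apply]; positivity

/-- Measuring the target qubit of a basis state. -/
lemma project_single (y : Bits n) (c : Bool) (i : Fin 2) :
    project (fun b : QBasis n 0 => if b.2.1 then (1 : Fin 2) else 0) i
      (Pi.single (y, c, fun _ => false) 1)
      = if i = (if c then 1 else 0) then Pi.single (y, c, fun _ => false) 1 else 0 := by
  ext ⟨z, b, w⟩
  cases c <;> cases b <;> fin_cases i <;> simp [project, Pi.single_apply]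

lemma weight_single (b : QBasis n 0) : weight (Pi.single b 1 : QVec n 0) = 1 := by
  rw [weight, Finset.sum_eq_single b]
  · simp
  · intro c _ hc
    simp [Pi.single_eq_of_ne hc]
  · simp

lemma weight_zero : weight (0 : QVec n 0) = 0 := by simp [weight]

lemma outputProb_verify (y : Bits n) {p : QProg n 0 (Option (Bits n))} (hp : IsFresh φ p)
    (o : Option (Bits n)) :
    (verify x y p).outputProb φ o
      = if marking φ x y = true then (if some y = o then 1 else 0) else p.outputProb φ o := by
  change (verify x y p).prob φ (zeroState n 0) o = _
  simp only [verify, prob, weight_zeroState, one_mul, verify_state, project_single,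
    Fin.sum_univ_two]
  cases h : marking φ x y <;> simp [weight_single, weight_zero, (hp _).1, prob]

lemma expectedCalls_verify (y : Bits n) {p : QProg n 0 (Option (Bits n))} (hp : IsFresh φ p) :
    (verify x y p).expectedCalls φ
      = 4 + if marking φ x y = true then 0 else p.expectedCalls φ := by
  have h4 : callsPerOracle = 4 := rfl
  change (verify x y p).calls φ (zeroState n 0) = _
  simp only [verify, calls, weight_zeroState, one_mul, verify_state, project_single,
    Fin.sum_univ_two, weight_mulVec, h4]
  cases h : marking φ x y <;> simp [weight_single, weight_zero, (hp _).2, calls]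

lemma prob_groverIterate (j : ℕ) (p : QProg n 0 (Option (Bits n))) (ψ : QVec n 0)
    (o : Option (Bits n)) :
    (groverIterate A x j p).prob φ ψ o = p.prob φ ((groverStep φ A x)^[j] ψ) o := by
  induction j generalizing ψ with
  | zero => rfl
  | succ j ih => rw [Function.iterate_succ_apply, ← ih]; rfl

lemma weight_groverStep (ψ : QVec n 0) : weight (groverStep φ A x ψ) = weight ψ := by
  rw [groverStep, weight_mulVec, weight_applyOracle]

lemma calls_groverIterate (j : ℕ) (p : QProg n 0 (Option (Bits n))) (ψ : QVec n 0) :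
    (groverIterate A x j p).calls φ ψ
      = 4 * j * weight ψ + p.calls φ ((groverStep φ A x)^[j] ψ) := by
  induction j generalizing ψ with
  | zero => simp [groverIterate]
  | succ j ih =>
    have h : (groverIterate A x (j + 1) p).calls φ ψ
        = 4 * weight ψ + (groverIterate A x j p).calls φ (groverStep φ A x ψ) := rfl
    rw [Function.iterate_succ_apply, h, ih, weight_groverStep]
    push_cast
    ring

lemma outputProb_trial (hA : A.Nonempty) (m : ℕ) {p : QProg n 0 (Option (Bits n))}
    (hp : IsFresh φ p) (o : Option (Bits n)) :
    (trial A x m p).outputProb φ o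
      = ∑ y ∈ marked φ A x, trialProb φ A x m y * (if some y = o then 1 else 0)
        + missProb φ A x m * p.outputProb φ o := by
  have hbranch : ∀ (j : ℕ) (y : Bits n),
      (if y ∈ A then verify x y p else p).prob φ
        (project argReg (Fintype.equivFin (Bits n) y) (groverState φ A x j)) o
      = hitProb φ A x j y *
        if y ∈ marked φ A x then (if some y = o then 1 else 0) else p.outputProb φ o := by
    intro j y
    by_cases hy : y ∈ A
    · rw [if_pos hy, (isFresh_verify y p _).1, outputProb_verify y hp, hitProb]
      simp only [marked, Finset.mem_filter, hy, true_and]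
    · rw [if_neg hy, (hp _).1, hitProb]
      simp only [marked, Finset.mem_filter, hy, false_and, if_false]
  change (trial A x m p).prob φ (zeroState n 0) o = _
  simp only [trial, prob, weight_zeroState, one_mul, prepare_searchVec hA, prob_groverIterate]
  have hj : ∀ j : Fin (m + 1), ∑ i, (if (Fintype.equivFin (Bits n)).symm i ∈ A
      then verify x ((Fintype.equivFin (Bits n)).symm i) p else p).prob φ
        (project argReg i ((groverStep φ A x)^[j] fun b => (searchVec A b : ℂ))) o
      = ∑ y, hitProb φ A x j y *
        if y ∈ marked φ A x then (if some y = o then 1 else 0) else p.outputProb φ o := by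
    intro j
    rw [← Equiv.sum_comp (Fintype.equivFin (Bits n))]
    refine Finset.sum_congr rfl fun y _ => ?_
    rw [← hbranch j y, Equiv.symm_apply_apply]
    rfl
  simp_rw [hj]
  rw [Finset.sum_comm, Finset.mul_sum]
  simp_rw [← Finset.sum_mul, ← mul_assoc]
  rw [← Finset.sum_add_sum_compl (marked φ A x), missProb, Finset.sum_mul]
  congr 1
  · exact Finset.sum_congr rfl fun y hy => by rw [if_pos hy]; rfl
  · exact Finset.sum_congr rfl fun y hy => by rw [if_neg (Finset.mem_compl.1 hy)]; rfl

lemma expectedCalls_trial_le (hA : A.Nonempty) (m : ℕ) {p : QProg n 0 (Option (Bits n))}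
    (hp : IsFresh φ p) :
    (trial A x m p).expectedCalls φ
      ≤ 4 * (m + 1) + missProb φ A x m * p.expectedCalls φ := by
  have hbranch : ∀ (j : ℕ) (y : Bits n),
      (if y ∈ A then verify x y p else p).calls φ
        (project argReg (Fintype.equivFin (Bits n) y) (groverState φ A x j))
      ≤ hitProb φ A x j y * 4 + hitProb φ A x j y *
        if y ∈ marked φ A x then 0 else p.expectedCalls φ := by
    intro j y
    rw [← mul_add]
    by_cases hy : y ∈ A
    · rw [if_pos hy, (isFresh_verify y p _).2, expectedCalls_verify y hp, hitProb]
      simp only [marked, Finset.mem_filter, hy, true_and, le_refl]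
    · rw [if_neg hy, (hp _).2, hitProb]
      simp only [marked, Finset.mem_filter, hy, false_and, if_false]
      gcongr
      exact le_add_self
  change (trial A x m p).calls φ (zeroState n 0) ≤ _
  simp only [trial, calls, weight_zeroState, one_mul, prepare_searchVec hA, calls_groverIterate]
  have hw : weight (fun b => (searchVec A b : ℂ)) = 1 := weight_groverState (φ := φ) (x := x) hA 0
  have hj : ∀ j : Fin (m + 1), 4 * ((j : ℕ) : ℝ≥0∞) * weight (fun b => (searchVec A b : ℂ)) +
      ∑ i, (if (Fintype.equivFin (Bits n)).symm i ∈ A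
        then verify x ((Fintype.equivFin (Bits n)).symm i) p else p).calls φ
        (project argReg i ((groverStep φ A x)^[j] fun b => (searchVec A b : ℂ)))
      ≤ 4 * (m + 1) + ∑ y, hitProb φ A x j y *
        if y ∈ marked φ A x then 0 else p.expectedCalls φ := by
    intro j
    rw [← Equiv.sum_comp (Fintype.equivFin (Bits n)), hw, mul_one, mul_add, add_assoc]
    gcongr
    · exact_mod_cast Nat.lt_succ_iff.1 j.2
    calc _ ≤ ∑ y, (hitProb φ A x j y * 4 + hitProb φ A x j y *
        if y ∈ marked φ A x then 0 else p.expectedCalls φ) :=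
          Finset.sum_le_sum fun y _ => by
            rw [Equiv.symm_apply_apply]
            exact hbranch j y
      _ = _ := by rw [Finset.sum_add_distrib, ← Finset.sum_mul, sum_hitProb hA, one_mul, mul_one]
  calc _ ≤ ((m + 1 : ℕ) : ℝ≥0∞)⁻¹ * ∑ j : Fin (m + 1), (4 * (m + 1) + ∑ y, hitProb φ A x j y *
        if y ∈ marked φ A x then 0 else p.expectedCalls φ) := by
        exact mul_le_mul' le_rfl (Finset.sum_le_sum fun j _ => hj j)
    _ = _ := by
      rw [Finset.sum_add_distrib, mul_add, inv_mul_sum_const]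
      congr 1
      rw [Finset.sum_comm, Finset.mul_sum]
      simp_rw [← Finset.sum_mul, ← mul_assoc]
      rw [← Finset.sum_add_sum_compl (marked φ A x), missProb, Finset.sum_mul]
      rw [Finset.sum_eq_zero fun y hy => by rw [if_pos hy, mul_zero], zero_add]
      exact Finset.sum_congr rfl fun y hy => by rw [if_neg (Finset.mem_compl.1 hy)]; rfl

end Search

/-! ### The output distribution of a search -/

section SearchOutput

variable {n : ℕ} {φ : Bits n → ℝ} {A : Finset (Bits n)} {x : Bits n}

open QProg

lemma missProb_le_one (hA : A.Nonempty) (m : ℕ) : missProb φ A x m ≤ 1 := by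
  rw [← sum_marked_add_missProb (φ := φ) (x := x) hA m]
  exact le_add_self

lemma outputProb_search_none (hA : A.Nonempty) (l : List ℕ) :
    (search A x l).outputProb φ none = (l.map (missProb φ A x)).prod := by
  induction l with
  | nil => simp [search, outputProb, prob, weight_zeroState]
  | cons m l ih => rw [search, outputProb_trial hA m (isFresh_search l), ih]; simp

lemma outputProb_search_some (hA : A.Nonempty) (m : ℕ) (l : List ℕ) {y : Bits n}
    (hy : y ∈ marked φ A x) :
    (search A x (m :: l)).outputProb φ (some y)
      = trialProb φ A x m y + missProb φ A x m * (search A x l).outputProb φ (some y) := by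
  rw [search, outputProb_trial hA m (isFresh_search l)]
  simp [hy]

lemma outputProb_search_congr (hA : A.Nonempty) (l : List ℕ) {y z : Bits n}
    (hy : y ∈ marked φ A x) (hz : z ∈ marked φ A x) :
    (search A x l).outputProb φ (some y) = (search A x l).outputProb φ (some z) := by
  induction l with
  | nil => simp [search, outputProb, prob]
  | cons m l ih =>
    rw [outputProb_search_some hA m l hy, outputProb_search_some hA m l hz, ih,
      trialProb_congr hy hz]

/-- A search outputs nothing but marked strings and `none`. -/
lemma sum_outputProb_search (hA : A.Nonempty) (l : List ℕ) :
    ∑ y ∈ marked φ A x, (search A x l).outputProb φ (some y)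
      + (search A x l).outputProb φ none = 1 := by
  induction l with
  | nil => simp [search, outputProb, prob, weight_zeroState]
  | cons m l ih =>
    rw [Finset.sum_congr rfl fun y hy => outputProb_search_some hA m l hy,
      Finset.sum_add_distrib, ← Finset.mul_sum, outputProb_search_none hA, List.map_cons,
      List.prod_cons, ← outputProb_search_none hA, add_assoc, ← mul_add, ih, mul_one,
      sum_marked_add_missProb hA]

/-- A bound on the number of queries of a search with schedule `l`, in terms of the failure
probabilities `q` of the trials. -/
def costBound (q : ℕ → ℝ) : List ℕ → ℝ
  | [] => 0
  | m :: l => 4 * (m + 1) + q m * costBound q l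

lemma costBound_nonneg {q : ℕ → ℝ} (hq : ∀ m, 0 ≤ q m) (l : List ℕ) : 0 ≤ costBound q l := by
  induction l with
  | nil => exact le_rfl
  | cons m l ih =>
    have := mul_nonneg (hq m) ih
    rw [costBound]
    positivity

lemma expectedCalls_search_le (hA : A.Nonempty) (l : List ℕ) :
    (search A x l).expectedCalls φ
      ≤ ENNReal.ofReal (costBound (fun m => (missProb φ A x m).toReal) l) := by
  induction l with
  | nil => simp [search, expectedCalls, calls]
  | cons m l ih =>
    have hc := costBound_nonneg (q := fun m => (missProb φ A x m).toReal)
      (fun _ => ENNReal.toReal_nonneg) l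
    refine (expectedCalls_trial_le hA m (isFresh_search l)).trans ?_
    rw [costBound, ENNReal.ofReal_add (by positivity) (mul_nonneg ENNReal.toReal_nonneg hc),
      ENNReal.ofReal_mul ENNReal.toReal_nonneg,
      ENNReal.ofReal_toReal ((missProb_le_one hA m).trans_lt ENNReal.one_lt_top).ne]
    gcongr
    rw [ENNReal.ofReal_mul (by norm_num), ENNReal.ofReal_add (by positivity) (by norm_num)]
    simp

end SearchOutput

/-! ### The schedule and its cost -/

/-- Three trials with each of `2 ^ i, …, 2 ^ (i + k - 1)` possible numbers of Grover iterations. -/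
def phases : ℕ → ℕ → List ℕ
  | 0, _ => []
  | k + 1, i => (2 ^ i - 1) :: (2 ^ i - 1) :: (2 ^ i - 1) :: phases k (i + 1)

/-- The phases `0, …, K`, all of them `R` times. -/
def schedule (R K : ℕ) : List ℕ := (List.replicate R (phases (K + 1) 0)).flatten

lemma schedule_succ (R K : ℕ) : schedule (R + 1) K = phases (K + 1) 0 ++ schedule R K := by
  simp [schedule, List.replicate_succ]

lemma cast_two_pow_sub_one_add_one (i : ℕ) : ((2 ^ i - 1 : ℕ) : ℝ) + 1 = 2 ^ i := by
  rw [Nat.cast_sub Nat.one_le_two_pow]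
  simp

section Schedule

variable {q : ℕ → ℝ}

lemma costBound_phases_append (h0 : ∀ m, 0 ≤ q m) (h1 : ∀ m, q m ≤ 1) (k i : ℕ) (l : List ℕ) :
    costBound q (phases k i ++ l) ≤ 12 * 2 ^ i * (2 ^ k - 1) + costBound q l := by
  induction k generalizing i with
  | zero => simp [phases]
  | succ k ih =>
    simp only [phases, List.cons_append, costBound, cast_two_pow_sub_one_add_one]
    have hX := costBound_nonneg h0 (phases k (i + 1) ++ l)
    specialize ih (i + 1)
    set X := costBound q (phases k (i + 1) ++ l)
    have hq0 := h0 (2 ^ i - 1)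
    have hq1 := h1 (2 ^ i - 1)
    set p := q (2 ^ i - 1)
    have hu : (0 : ℝ) < 2 ^ i := by positivity
    have e1 : p * X ≤ X := mul_le_of_le_one_left hX hq1
    have e2 : p * (4 * 2 ^ i + p * X) ≤ 4 * 2 ^ i + p * X :=
      mul_le_of_le_one_left (by positivity) hq1
    have e3 : p * (4 * 2 ^ i + p * (4 * 2 ^ i + p * X)) ≤ 4 * 2 ^ i + p * (4 * 2 ^ i + p * X) :=
      mul_le_of_le_one_left (by positivity) hq1
    rw [pow_succ] at ih ⊢
    linarith

/-- Below the threshold `s` the cost of the phases doubles and is dominated by its last term; above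
it, the probability `(3/4)³ < 1/2` of reaching the next phase outweighs the doubling. With `u = 2 ^ i`,
the bound `F u` on the right is chosen to satisfy `F u ≥ 12 u + F (2 u)` below the threshold and
`F u ≥ (1 + 3/4 + 9/16) 4 u + (27/64) F (2 u)` above it. -/
lemma costBound_phases_append_of_threshold (h0 : ∀ m, 0 ≤ q m) (h1 : ∀ m, q m ≤ 1) {s : ℝ}
    (hs : ∀ m : ℕ, s ≤ m + 1 → q m ≤ 3 / 4) (k i : ℕ) (l : List ℕ) :
    costBound q (phases k i ++ l)
      ≤ (if s ≤ 2 ^ i then 77 * 2 ^ i else 178 * s - 12 * 2 ^ i) + costBound q l := by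
  induction k generalizing i with
  | zero =>
    have hu : (0 : ℝ) < 2 ^ i := by positivity
    simp only [phases, List.nil_append, le_add_iff_nonneg_left]
    split_ifs <;> linarith
  | succ k ih =>
    simp only [phases, List.cons_append, costBound, cast_two_pow_sub_one_add_one]
    have hX := costBound_nonneg h0 (phases k (i + 1) ++ l)
    have hD := costBound_nonneg h0 l
    specialize ih (i + 1)
    set X := costBound q (phases k (i + 1) ++ l)
    have hq0 := h0 (2 ^ i - 1)
    have hq1 := h1 (2 ^ i - 1)
    have hq2 := hs (2 ^ i - 1)
    rw [cast_two_pow_sub_one_add_one] at hq2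
    set p := q (2 ^ i - 1)
    rw [pow_succ] at ih
    have hu : (0 : ℝ) < 2 ^ i := by positivity
    set u : ℝ := 2 ^ i
    have key : ∀ c, p ≤ c →
        4 * u + p * (4 * u + p * (4 * u + p * X)) ≤ 4 * u + c * (4 * u + c * (4 * u + c * X)) :=
      fun c hc => by
        have : 0 ≤ c := hq0.trans hc
        gcongr
    split_ifs with hsu
    · have := key _ (hq2 hsu)
      rw [if_pos (by linarith)] at ih
      linarith
    · have := key _ hq1
      push Not at hsu
      split_ifs at ih <;> linarith

lemma prod_map_phases_le (h0 : ∀ m, 0 ≤ q m) (h1 : ∀ m, q m ≤ 1) {s : ℝ}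
    (hs : ∀ m : ℕ, s ≤ m + 1 → q m ≤ 3 / 4) (k i : ℕ) (hk : s ≤ 2 ^ (i + k)) :
    ((phases (k + 1) i).map q).prod ≤ 27 / 64 := by
  induction k generalizing i with
  | zero =>
    have := hs (2 ^ i - 1) (by rwa [cast_two_pow_sub_one_add_one])
    simp only [phases, List.map_cons, List.map_nil, List.prod_cons, List.prod_nil, mul_one]
    calc q (2 ^ i - 1) * (q (2 ^ i - 1) * q (2 ^ i - 1)) ≤ 3 / 4 * (3 / 4 * (3 / 4)) := by
          have := h0 (2 ^ i - 1)
          gcongr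
      _ = 27 / 64 := by norm_num
  | succ k ih =>
    have hi := ih (i + 1) (by rwa [add_assoc, add_comm 1 k])
    rw [phases]
    have hp : 0 ≤ ((phases (k + 1) (i + 1)).map q).prod :=
      List.prod_nonneg (by simpa using fun m _ => h0 m)
    simp only [List.map_cons, List.prod_cons]
    have h := h0 (2 ^ i - 1)
    have h' := h1 (2 ^ i - 1)
    calc q (2 ^ i - 1) * (q (2 ^ i - 1) * (q (2 ^ i - 1) * ((phases (k + 1) (i + 1)).map q).prod))
        ≤ 1 * (1 * (1 * ((phases (k + 1) (i + 1)).map q).prod)) := by gcongr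
      _ ≤ 27 / 64 := by linarith

lemma prod_map_schedule_le (h0 : ∀ m, 0 ≤ q m) (h1 : ∀ m, q m ≤ 1) {s : ℝ}
    (hs : ∀ m : ℕ, s ≤ m + 1 → q m ≤ 3 / 4) (R K : ℕ) (hK : s ≤ 2 ^ K) :
    ((schedule R K).map q).prod ≤ (27 / 64) ^ R := by
  induction R with
  | zero => simp [schedule]
  | succ R ih =>
    rw [schedule_succ, List.map_append, List.prod_append, pow_succ']
    have hp : 0 ≤ ((schedule R K).map q).prod :=
      List.prod_nonneg (by simpa using fun m _ => h0 m)
    have := prod_map_phases_le h0 h1 hs K 0 (by simpa using hK)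
    gcongr

lemma costBound_schedule_le (K : ℕ) (E : ℝ)
    (hE : ∀ l, costBound q (phases (K + 1) 0 ++ l) ≤ E + costBound q l) (R : ℕ) :
    costBound q (schedule R K) ≤ R * E := by
  induction R with
  | zero => simp [schedule, costBound]
  | succ R ih =>
    rw [schedule_succ]
    push_cast
    linarith [hE (schedule R K)]

end Schedule

/-! ### The error allowed to a search -/

lemma one_sub_stepError_pow {T : ℕ} (hT : 1 ≤ T) : (1 - stepError T) ^ T = 2 / 3 := by
  have : (T : ℝ) ≠ 0 := by positivity
  rw [stepError, sub_sub_cancel, ← Real.rpow_natCast, ← Real.rpow_mul (by norm_num),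
    one_div_mul_cancel this, Real.rpow_one]

lemma stepError_pos {T : ℕ} (hT : 1 ≤ T) : 0 < stepError T := by
  have : (0 : ℝ) < T := by positivity
  have := Real.rpow_lt_one (x := 2 / 3) (z := 1 / (T : ℝ)) (by norm_num) (by norm_num)
    (by positivity)
  rw [stepError]
  linarith

lemma stepError_le {T : ℕ} (hT : 1 ≤ T) : stepError T ≤ 1 / 3 := by
  have h : (1 : ℝ) / T ≤ 1 := by
    rw [div_le_one (by positivity)]
    exact_mod_cast hT
  have := Real.rpow_le_rpow_of_exponent_ge (x := 2 / 3) (by norm_num) (by norm_num) h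
  rw [Real.rpow_one] at this
  rw [stepError]
  linarith

lemma one_le_log_inv_stepError {T : ℕ} (hT : 1 ≤ T) : 1 ≤ Real.log (1 / stepError T) := by
  have h0 := stepError_pos hT
  rw [Real.le_log_iff_exp_le (by positivity)]
  have : (3 : ℝ) ≤ 1 / stepError T := by
    rw [le_div_iff₀ h0]
    linarith [stepError_le hT]
  linarith [Real.exp_one_lt_d9]

/-- The number of repetitions that brings the error down from `27/64` to `stepError T`. -/
def repetitions (T : ℕ) : ℕ := ⌈2 * Real.log (1 / stepError T)⌉₊

lemma repetitions_le {T : ℕ} (hT : 1 ≤ T) :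
    (repetitions T : ℝ) ≤ 3 * Real.log (1 / stepError T) := by
  have h := one_le_log_inv_stepError hT
  have := Nat.ceil_lt_add_one (a := 2 * Real.log (1 / stepError T)) (by linarith)
  rw [repetitions]
  linarith

lemma pow_repetitions_le {T : ℕ} (hT : 1 ≤ T) :
    (27 / 64 : ℝ) ^ repetitions T ≤ stepError T := by
  have h0 := stepError_pos hT
  have h : (27 / 64 : ℝ) ≤ Real.exp (-1 / 2) := by
    linarith [Real.add_one_le_exp (-1 / 2 : ℝ)]
  calc (27 / 64 : ℝ) ^ repetitions T ≤ Real.exp (-1 / 2) ^ repetitions T := by gcongr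
    _ = Real.exp (repetitions T * (-1 / 2)) := by rw [Real.exp_nat_mul]
    _ ≤ Real.exp (-Real.log (1 / stepError T)) := by
      have := Nat.le_ceil (2 * Real.log (1 / stepError T))
      rw [Real.exp_le_exp, repetitions]
      linarith
    _ = stepError T := by rw [one_div, Real.log_inv, neg_neg, Real.exp_log h0]

/-! ### The local search step -/

section LocalSearch

variable {n : ℕ} {φ : Bits n → ℝ}

open QProg

/-- Quantum search for an improving string in the neighbourhood of `x`. The last phase admits at
least `√N` numbers of Grover iterations, where `N` is the size of the neighbourhood. -/
def localSearch (d T : ℕ) (x : Bits n) : QProg n 0 (Option (Bits n)) :=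
  if (neighbourhood d x).Nonempty then
    search (neighbourhood d x) x
      (schedule (repetitions T) (Nat.log 4 (neighbourhood d x).card + 1))
  else .done none

lemma improving_subset (φ : Bits n → ℝ) (d : ℕ) (x : Bits n) :
    improving φ d x ⊆ neighbourhood d x := Finset.filter_subset _ _

/-- A local search outputs nothing but improving strings and `none`. -/
lemma sum_outputProb_localSearch (φ : Bits n → ℝ) (d T : ℕ) (x : Bits n) :
    ∑ y ∈ improving φ d x, (localSearch d T x).outputProb φ (some y)
      + (localSearch d T x).outputProb φ none = 1 := by
  unfold localSearch
  split_ifs with h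
  · exact sum_outputProb_search h _
  · simp [outputProb, prob, weight_zeroState]

lemma outputProb_localSearch_congr (d T : ℕ) (x : Bits n) {y z : Bits n}
    (hy : y ∈ improving φ d x) (hz : z ∈ improving φ d x) :
    (localSearch d T x).outputProb φ (some y) = (localSearch d T x).outputProb φ (some z) := by
  have h : (neighbourhood d x).Nonempty := ⟨y, improving_subset φ d x hy⟩
  rw [localSearch, if_pos h]
  exact outputProb_search_congr h _ hy hz

lemma two_pow_log_bounds {N : ℕ} (hN : 0 < N) :
    √(N : ℝ) ≤ 2 ^ (Nat.log 4 N + 1) ∧ (2 : ℝ) ^ (Nat.log 4 N + 1) ≤ 2 * √(N : ℝ) := by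
  have e : ∀ k : ℕ, ((2 : ℝ) ^ k) ^ 2 = (4 ^ k : ℕ) := fun k => by
    push_cast
    rw [← pow_mul, mul_comm, pow_mul]
    norm_num
  constructor
  · rw [Real.sqrt_le_left (by positivity), e]
    exact_mod_cast (Nat.lt_pow_succ_log_self (by norm_num) N).le
  · rw [pow_succ, mul_comm]
    gcongr
    refine Real.le_sqrt_of_sq_le ?_
    rw [e]
    exact_mod_cast Nat.pow_log_le_self 4 hN.ne'

lemma missProb_threshold {d : ℕ} {x : Bits n} (h : (improving φ d x).Nonempty) (m : ℕ)
    (hm : searchBound φ d x ≤ m + 1) :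
    (missProb φ (neighbourhood d x) x m).toReal ≤ 3 / 4 := by
  refine missProb_le h m ?_
  have ht : (0 : ℝ) < (improving φ d x).card := by exact_mod_cast h.card_pos
  rw [searchBound, if_pos h, improvingFraction, one_div_div, Real.sqrt_le_left (by positivity),
    div_le_iff₀ ht] at hm
  exact hm

lemma searchBound_le_sqrt (φ : Bits n → ℝ) (d : ℕ) (x : Bits n) :
    searchBound φ d x ≤ √((neighbourhood d x).card : ℝ) := by
  rw [searchBound]
  split_ifs with h
  · rw [improvingFraction, one_div_div]
    refine Real.sqrt_le_sqrt (div_le_self (by positivity) ?_)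
    exact_mod_cast h.card_pos
  · exact le_rfl

lemma searchBound_nonneg (φ : Bits n → ℝ) (d : ℕ) (x : Bits n) : 0 ≤ searchBound φ d x := by
  rw [searchBound]
  split_ifs <;> exact Real.sqrt_nonneg _

lemma outputProb_localSearch_none_le {d T : ℕ} (hT : 1 ≤ T) {x : Bits n}
    (h : (improving φ d x).Nonempty) :
    (localSearch d T x).outputProb φ none ≤ ENNReal.ofReal (stepError T) := by
  have hA : (neighbourhood d x).Nonempty := h.mono (improving_subset φ d x)
  have hq : ∀ m, missProb φ (neighbourhood d x) x m
      = ENNReal.ofReal (missProb φ (neighbourhood d x) x m).toReal := fun m =>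
    (ENNReal.ofReal_toReal ((missProb_le_one hA m).trans_lt ENNReal.one_lt_top).ne).symm
  have hprod : ∀ l : List ℕ, (l.map (missProb φ (neighbourhood d x) x)).prod = ENNReal.ofReal
      (l.map fun m => (missProb φ (neighbourhood d x) x m).toReal).prod := by
    intro l
    induction l with
    | nil => simp
    | cons m l ih =>
      rw [List.map_cons, List.prod_cons, List.map_cons, List.prod_cons,
        ENNReal.ofReal_mul ENNReal.toReal_nonneg, ← hq, ih]
  rw [localSearch, if_pos hA, outputProb_search_none hA, hprod]
  refine ENNReal.ofReal_le_ofReal ((prod_map_schedule_le (fun _ => ENNReal.toReal_nonneg)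
    (fun m => ?_) (missProb_threshold h) _ _ ?_).trans (pow_repetitions_le hT))
  · exact ENNReal.toReal_le_of_le_ofReal zero_le_one (by simpa using missProb_le_one hA m)
  · exact (searchBound_le_sqrt φ d x).trans (two_pow_log_bounds hA.card_pos).1

lemma expectedCalls_localSearch_le {d T : ℕ} (hT : 1 ≤ T) (x : Bits n) :
    (localSearch d T x).expectedCalls φ ≤ ENNReal.ofReal
      (534 * Real.log (1 / stepError T) * searchBound φ d x) := by
  rw [localSearch]
  split_ifs with hA
  · have hq0 : ∀ m, 0 ≤ (missProb φ (neighbourhood d x) x m).toReal := fun _ =>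
      ENNReal.toReal_nonneg
    have hq1 : ∀ m, (missProb φ (neighbourhood d x) x m).toReal ≤ 1 := fun m =>
      ENNReal.toReal_le_of_le_ofReal zero_le_one (by simpa using missProb_le_one hA m)
    have hB := searchBound_nonneg φ d x
    refine (expectedCalls_search_le hA _).trans (ENNReal.ofReal_le_ofReal ?_)
    have hE : ∀ l, costBound (fun m => (missProb φ (neighbourhood d x) x m).toReal)
        (phases (Nat.log 4 (neighbourhood d x).card + 1 + 1) 0 ++ l)
        ≤ 178 * searchBound φ d x
          + costBound (fun m => (missProb φ (neighbourhood d x) x m).toReal) l := by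
      intro l
      by_cases h : (improving φ d x).Nonempty
      · refine (costBound_phases_append_of_threshold hq0 hq1 (missProb_threshold h) _ _ _).trans ?_
        gcongr
        have h1 : 1 ≤ searchBound φ d x := by
          have ht : (0 : ℝ) < (improving φ d x).card := by exact_mod_cast h.card_pos
          rw [searchBound, if_pos h, improvingFraction, one_div_div, Real.one_le_sqrt,
            one_le_div ht]
          exact_mod_cast Finset.card_le_card (improving_subset φ d x)
        split_ifs <;> linarith [pow_zero (2 : ℝ)]
      · refine (costBound_phases_append hq0 hq1 _ _ _).trans ?_
        refine add_le_add ?_ le_rfl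
        rw [searchBound, if_neg h, pow_succ]
        linarith [(two_pow_log_bounds hA.card_pos).2,
          Real.sqrt_nonneg ((neighbourhood d x).card : ℝ)]
    refine (costBound_schedule_le _ _ hE _).trans ?_
    nlinarith [mul_le_mul_of_nonneg_right (repetitions_le hT) hB]
  · simp [expectedCalls, calls]

lemma isLocalQSearch_localSearch (φ : Bits n → ℝ) (d : ℕ) {T : ℕ} (hT : 1 ≤ T) :
    IsLocalQSearch φ d (stepError T)
      (fun x => 534 * Real.log (1 / stepError T) * searchBound φ d x) (localSearch d T) where
  finds x h := by
    have h1 := sum_outputProb_localSearch φ d T x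
    have h2 := outputProb_localSearch_none_le hT h
    rw [ENNReal.ofReal_sub _ (stepError_pos hT).le, ENNReal.ofReal_one, tsub_le_iff_right, ← h1]
    gcongr
  confirms x h := by
    have h1 := sum_outputProb_localSearch φ d T x
    rwa [Finset.not_nonempty_iff_eq_empty.1 h, Finset.sum_empty, zero_add] at h1
  calls_le x := expectedCalls_localSearch_le hT x

end LocalSearch

/-! ### The hill climbers as random processes -/

section Climbers

variable {n a : ℕ} {φ : Bits n → ℝ}

open QProg

lemma QProg.outputPMF_bind {α β : Type} (p : QProg n a α) (q : α → QProg n a β)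
    (hq : ∀ o, IsFresh φ (q o)) :
    (p.bind q).outputPMF φ = (p.outputPMF φ).bind fun o => (q o).outputPMF φ := by
  ext o
  rw [PMF.bind_apply]
  exact prob_bind φ p q hq _ o

lemma QProg.outputPMF_done {α : Type} (o : α) :
    (done o : QProg n a α).outputPMF φ = PMF.pure o := by
  ext o'
  rw [PMF.pure_apply, outputPMF_apply, outputProb, prob, weight_zeroState]
  split_ifs <;> simp_all

lemma QProg.outputPMF_init {α : Type} (p : QProg n a α) :
    (init p).outputPMF φ = p.outputPMF φ := by
  ext o
  simp [outputPMF_apply, outputProb, prob, weight_zeroState]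

/-- What the quantum hill climber does after the local search at `x`. -/
def climbNext (S : Bits n → QProg n a (Option (Bits n))) (T : ℕ) (x : Bits n) :
    Option (Bits n) → QProg n a (List (Bits n))
  | none => .done [x]
  | some y => (quantumHillClimber S T y).bind fun l => .done (x :: l)

variable (S : Bits n → QProg n a (Option (Bits n))) (T : ℕ) (x : Bits n)

lemma quantumHillClimber_succ :
    quantumHillClimber S (T + 1) x = .init ((S x).bind (climbNext S T x)) := by
  rw [quantumHillClimber]
  congr 2

lemma isFresh_climbNext (o : Option (Bits n)) : IsFresh φ (climbNext S T x o) := by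
  rcases o with _ | y
  · exact isFresh_done _ _
  · cases T
    · exact isFresh_done _ _
    · exact isFresh_init _ _

lemma outputPMF_climbNext_some (y : Bits n) :
    (climbNext S T x (some y)).outputPMF φ
      = ((quantumHillClimber S T y).outputPMF φ).map fun l => x :: l := by
  rw [climbNext, outputPMF_bind _ _ fun _ => isFresh_done _ _]
  simp_rw [outputPMF_done]
  rfl

lemma outputPMF_quantumHillClimber_succ :
    (quantumHillClimber S (T + 1) x).outputPMF φ
      = ((S x).outputPMF φ).bind fun o => (climbNext S T x o).outputPMF φ := by
  rw [quantumHillClimber_succ, outputPMF_init, outputPMF_bind _ _ (isFresh_climbNext S T x)]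

lemma expectedCalls_quantumHillClimber_succ :
    (quantumHillClimber S (T + 1) x).expectedCalls φ = (S x).expectedCalls φ
      + ∑' o, (S x).outputPMF φ o * (climbNext S T x o).expectedCalls φ := by
  rw [quantumHillClimber_succ, expectedCalls, calls, weight_zeroState, one_mul,
    calls_bind _ _ _ (isFresh_climbNext S T x)]
  rfl

lemma expectedCalls_climbNext_some (y : Bits n) :
    (climbNext S T x (some y)).expectedCalls φ = (quantumHillClimber S T y).expectedCalls φ := by
  rw [climbNext, expectedCalls, calls_bind _ _ _ fun _ => isFresh_done _ _]
  simp [expectedCalls, calls]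

lemma PMF.tsum_bind_mul {α β : Type} (p : PMF α) (f : α → PMF β) (g : β → ℝ≥0∞) :
    ∑' b, p.bind f b * g b = ∑' i, p i * ∑' b, f i b * g b := by
  simp_rw [PMF.bind_apply, ← ENNReal.tsum_mul_right, ← ENNReal.tsum_mul_left]
  rw [ENNReal.tsum_comm]
  simp_rw [mul_assoc]

lemma PMF.tsum_pure_mul {α : Type} (i : α) (g : α → ℝ≥0∞) :
    ∑' b, PMF.pure i b * g b = g i := by
  rw [tsum_eq_single i]
  · simp
  · intro b hb
    simp [PMF.pure_apply, hb]

/-- The expected number of calls of the quantum hill climber is the expected sum of the bounds for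
its local searches. -/
lemma expectedCalls_quantumHillClimber_le {B : Bits n → ℝ} (hB : ∀ x, 0 ≤ B x)
    (hS : ∀ x, (S x).expectedCalls φ ≤ ENNReal.ofReal (B x)) :
    (quantumHillClimber S T x).expectedCalls φ ≤
      ∑' l, (quantumHillClimber S T x).outputPMF φ l * ENNReal.ofReal ((l.take T).map B).sum := by
  induction T generalizing x with
  | zero => simp [quantumHillClimber, expectedCalls, calls]
  | succ T ih =>
    rw [expectedCalls_quantumHillClimber_succ, outputPMF_quantumHillClimber_succ,
      PMF.tsum_bind_mul]
    calc _ ≤ (∑' o, (S x).outputPMF φ o * ENNReal.ofReal (B x))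
          + ∑' o, (S x).outputPMF φ o * (climbNext S T x o).expectedCalls φ := by
          rw [ENNReal.tsum_mul_right, PMF.tsum_coe, one_mul]
          gcongr
          exact hS x
      _ = ∑' o, (S x).outputPMF φ o *
          (ENNReal.ofReal (B x) + (climbNext S T x o).expectedCalls φ) := by
          rw [← ENNReal.tsum_add]
          simp_rw [mul_add]
      _ ≤ _ := by
          gcongr with o
          rcases o with _ | y
          · rw [climbNext, outputPMF_done, PMF.tsum_pure_mul]
            simp [expectedCalls, calls]
          · rw [outputPMF_climbNext_some, expectedCalls_climbNext_some, PMF.map,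
              PMF.tsum_bind_mul]
            simp only [Function.comp_apply, PMF.tsum_pure_mul, List.take_succ_cons, List.map_cons,
              List.sum_cons]
            have hsum : ∀ l : List (Bits n), 0 ≤ ((l.take T).map B).sum := fun l =>
              List.sum_nonneg fun v hv => by
                obtain ⟨b, -, rfl⟩ := List.mem_map.1 hv
                exact hB b
            simp_rw [ENNReal.ofReal_add (hB x) (hsum _), mul_add]
            rw [ENNReal.tsum_add, ENNReal.tsum_mul_right, PMF.tsum_coe, one_mul]
            gcongr
            exact ih y

/-! ### Coupling with the classical hill climber -/

lemma classicalHillClimber_succ_of_nonempty {d : ℕ} {x : Bits n} (T : ℕ)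
    (h : (improving φ d x).Nonempty) :
    classicalHillClimber φ d (T + 1) x = (PMF.uniformOfFinset (improving φ d x) h).bind fun y =>
        (classicalHillClimber φ d T y).map fun l => x :: l := by
  rw [classicalHillClimber, dif_pos h]

lemma classicalHillClimber_succ_of_not_nonempty {d : ℕ} {x : Bits n} (T : ℕ)
    (h : ¬ (improving φ d x).Nonempty) :
    classicalHillClimber φ d (T + 1) x = PMF.pure [x] := by
  rw [classicalHillClimber, dif_neg h]

lemma PMF.bind_uniformOfFinset_apply {α β : Type} [Fintype α] [DecidableEq α] (s : Finset α)
    (hs : s.Nonempty) (f : α → PMF β) (b : β) :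
    (PMF.uniformOfFinset s hs).bind f b = (s.card : ℝ≥0∞)⁻¹ * ∑ i ∈ s, f i b := by
  rw [PMF.bind_apply, tsum_fintype, Finset.mul_sum]
  symm
  refine Finset.sum_subset_zero_on_sdiff (Finset.subset_univ s) (fun i hi => ?_) fun i hi => ?_
  · rw [PMF.uniformOfFinset_apply_of_notMem hs (Finset.mem_sdiff.1 hi).2, zero_mul]
  · rw [PMF.uniformOfFinset_apply_of_mem hs hi]

/-- If a random choice is uniform on `s`, then it stays so when, with the remaining probability, it
is replaced by a uniform choice from `s`. -/
lemma PMF.bind_resample {α β : Type} [Fintype α] [DecidableEq α] (s : Finset α) (hs : s.Nonempty)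
    (μ : PMF (Option α)) (hμ : ∀ y ∈ s, ∀ z ∈ s, μ (some y) = μ (some z)) (f : α → PMF β)
    (κ : Option α → PMF β) (h1 : ∀ y ∈ s, κ (some y) = f y)
    (h2 : κ none = (PMF.uniformOfFinset s hs).bind f)
    (h3 : ∀ y ∉ s, κ (some y) = (PMF.uniformOfFinset s hs).bind f) :
    μ.bind κ = (PMF.uniformOfFinset s hs).bind f := by
  ext b
  have htot : μ none + (∑ y ∈ s, μ (some y) + ∑ y ∈ sᶜ, μ (some y)) = 1 := by
    rw [Finset.sum_add_sum_compl, ← Fintype.sum_option fun o => μ o,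
      ← tsum_fintype (L := .unconditional _), PMF.tsum_coe]
  obtain ⟨z, hz⟩ := id hs
  have hc : (s.card : ℝ≥0∞) ≠ 0 := by
    simpa using Finset.ne_empty_of_mem hz
  have hgood : ∑ y ∈ s, μ (some y) * κ (some y) b
      = (∑ y ∈ s, μ (some y)) * (PMF.uniformOfFinset s hs).bind f b := by
    rw [PMF.bind_uniformOfFinset_apply,
      Finset.sum_congr rfl fun y hy => by rw [hμ y hy z hz, h1 y hy],
      Finset.sum_congr rfl fun y hy => hμ y hy z hz, Finset.sum_const, nsmul_eq_mul,
      ← Finset.mul_sum, mul_right_comm, ← mul_assoc, ENNReal.mul_inv_cancel hc (by simp), one_mul,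
      mul_comm]
  have hbad : ∑ y ∈ sᶜ, μ (some y) * κ (some y) b
      = (∑ y ∈ sᶜ, μ (some y)) * (PMF.uniformOfFinset s hs).bind f b := by
    rw [Finset.sum_mul]
    exact Finset.sum_congr rfl fun y hy => by rw [h3 y (Finset.mem_compl.1 hy)]
  rw [PMF.bind_apply, tsum_fintype, Fintype.sum_option, h2,
    ← Finset.sum_add_sum_compl s, hgood, hbad, ← add_mul, ← add_mul, htot, one_mul]

/-- If each local search finds a uniformly distributed improving string with probability at least
`δ`, and stops with certainty when there is none, then the quantum and the classical hill climber
can be coupled to agree with probability at least `δ ^ T`: they move together as long as the search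
succeeds, and independently from the first failure on. -/
lemma exists_coupling {d : ℕ} {δ : ℝ≥0∞} (hδ : δ ≤ 1)
    (hfind : ∀ x, (improving φ d x).Nonempty →
      δ ≤ ∑ y ∈ improving φ d x, (S x).outputPMF φ (some y))
    (hconfirm : ∀ x, ¬ (improving φ d x).Nonempty → (S x).outputPMF φ none = 1)
    (hunif : ∀ x, ∀ y ∈ improving φ d x, ∀ z ∈ improving φ d x,
      (S x).outputPMF φ (some y) = (S x).outputPMF φ (some z)) :
    ∃ π : PMF (List (Bits n) × List (Bits n)),
      π.map Prod.fst = (quantumHillClimber S T x).outputPMF φ ∧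
      π.map Prod.snd = classicalHillClimber φ d T x ∧
      δ ^ T ≤ π.toOuterMeasure {l | l.1 = l.2} := by
  induction T generalizing x with
  | zero =>
    refine ⟨PMF.pure ([x], [x]), ?_, ?_, ?_⟩
    · rw [PMF.pure_map, quantumHillClimber, outputPMF_done]
    · rw [PMF.pure_map, classicalHillClimber]
    · simp
  | succ T ih =>
    by_cases h : (improving φ d x).Nonempty
    · choose π hfst hsnd hπ using ih
      -- `far` is the independent continuation after a search that did not find an improving string
      let far (o : Option (Bits n)) : PMF (List (Bits n) × List (Bits n)) :=
        ((climbNext S T x o).outputPMF φ).bind fun l =>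
          (classicalHillClimber φ d (T + 1) x).map fun l' => (l, l')
      have far_fst : ∀ o, (far o).map Prod.fst = (climbNext S T x o).outputPMF φ := fun o => by
        simp only [far, PMF.map_bind, PMF.map_comp]
        have : ∀ l : List (Bits n), Prod.fst ∘ (fun l' : List (Bits n) => (l, l'))
            = Function.const _ l := fun l => rfl
        simp_rw [this, PMF.map_const, PMF.bind_pure]
      have far_snd : ∀ o, (far o).map Prod.snd = classicalHillClimber φ d (T + 1) x := fun o => by
        simp only [far, PMF.map_bind, PMF.map_comp]
        have : ∀ l : List (Bits n), Prod.snd ∘ (fun l' : List (Bits n) => (l, l')) = id :=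
          fun l => rfl
        simp_rw [this, PMF.map_id, PMF.bind_const]
      let κ : Option (Bits n) → PMF (List (Bits n) × List (Bits n))
        | none => far none
        | some y => if y ∈ improving φ d x then
            (π y).map (Prod.map (fun l => x :: l) fun l => x :: l) else far (some y)
      refine ⟨((S x).outputPMF φ).bind κ, ?_, ?_, ?_⟩
      · rw [PMF.map_bind, outputPMF_quantumHillClimber_succ]
        congr 1
        funext o
        rcases o with _ | y
        · exact far_fst none
        · by_cases hy : y ∈ improving φ d x
          · simp only [κ, if_pos hy]
            rw [outputPMF_climbNext_some, ← hfst, PMF.map_comp, PMF.map_comp]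
            rfl
          · simp only [κ, if_neg hy]
            exact far_fst _
      · rw [PMF.map_bind, classicalHillClimber_succ_of_nonempty T h]
        refine PMF.bind_resample _ h _ (hunif x) _ _ (fun y hy => ?_) ?_ fun y hy => ?_
        · simp only [κ, if_pos hy]
          rw [← hsnd, PMF.map_comp, PMF.map_comp]
          rfl
        · rw [← classicalHillClimber_succ_of_nonempty]
          exact far_snd none
        · simp only [κ, if_neg hy]
          rw [← classicalHillClimber_succ_of_nonempty]
          exact far_snd _
      · rw [PMF.toOuterMeasure_bind_apply, tsum_fintype, Fintype.sum_option]
        calc δ ^ (T + 1) ≤ (∑ y ∈ improving φ d x, (S x).outputPMF φ (some y)) * δ ^ T := by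
              rw [pow_succ']
              gcongr
              exact hfind x h
          _ ≤ ∑ y ∈ improving φ d x, (S x).outputPMF φ (some y) *
                (κ (some y)).toOuterMeasure {l | l.1 = l.2} := by
              rw [Finset.sum_mul]
              gcongr with y hy
              simp only [κ, if_pos hy]
              rw [PMF.toOuterMeasure_map_apply]
              refine (hπ y).trans ((π y).toOuterMeasure.mono fun l hl => ?_)
              simp only [Set.mem_ofPred_eq, Set.mem_preimage, Prod.map_fst, Prod.map_snd] at hl ⊢
              rw [hl]
          _ ≤ ∑ y, (S x).outputPMF φ (some y) *
                (κ (some y)).toOuterMeasure {l | l.1 = l.2} :=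
              Finset.sum_le_sum_of_subset (Finset.subset_univ _)
          _ ≤ _ := le_add_self
    · have hpure : (S x).outputPMF φ = PMF.pure none := by
        have hs := (PMF.apply_eq_one_iff _ _).1 (hconfirm x h)
        ext o
        rcases o with _ | y
        · simp [hconfirm x h]
        · have : some y ∉ ((S x).outputPMF φ).support := by simp [hs]
          rw [PMF.mem_support_iff, not_not] at this
          simp [this]
      refine ⟨PMF.pure ([x], [x]), ?_, ?_, ?_⟩
      · rw [PMF.pure_map, outputPMF_quantumHillClimber_succ, hpure, PMF.pure_bind, climbNext,
          outputPMF_done]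
      · rw [PMF.pure_map, classicalHillClimber_succ_of_not_nonempty T h]
      · simpa using pow_le_one₀ zero_le hδ

end Climbers

end
theorem mainTheorem11 :
    ∃ C : ℝ, 0 < C ∧ ∀ n d T : ℕ, 1 ≤ T →
      -- the algorithm is fixed before the instance, which it sees only through the oracles
      ∃ (a : ℕ) (S : Bits n → QProg n a (Option (Bits n))),
        ∀ (k : ℕ) (I : MaxKSat n k),
          -- each local search step is a quantum search with error `1 - (2/3)^{1/T}`
          IsLocalQSearch I.objective d (stepError T)
            (fun x => C * Real.log (1 / stepError T) * searchBound I.objective d x) S ∧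
          ∀ x₀ : Bits n,
            -- with probability at least `2/3` it behaves identically to the classical climber
            (∃ π : PMF (List (Bits n) × List (Bits n)),
              (∀ l, π.map Prod.fst l
                = (quantumHillClimber S T x₀).outputProb I.objective l) ∧
              π.map Prod.snd = classicalHillClimber I.objective d T x₀ ∧
              2 / 3 ≤ π.toOuterMeasure {l | l.1 = l.2}) ∧
            -- expected number of calls to the objective function; the right-hand side is the
            -- expectation of the sum over the strings at which a local search is performed
            (quantumHillClimber S T x₀).expectedCalls I.objective ≤
              ∑' l : List (Bits n), (quantumHillClimber S T x₀).outputProb I.objective l *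
                ENNReal.ofReal (((l.take T).map fun x =>
                  C * Real.log (1 / stepError T) * searchBound I.objective d x).sum) := by
  -- each of at most `3 log(1/ε)` repetitions costs at most `178` times the search bound
  refine ⟨534, by norm_num, fun n d T hT => ⟨0, localSearch d T, fun k I => ?_⟩⟩
  have hS := isLocalQSearch_localSearch I.objective d hT
  refine ⟨hS, fun x₀ => ⟨?_, ?_⟩⟩
  · have hε : ENNReal.ofReal (1 - stepError T) ≤ 1 :=
      ENNReal.ofReal_le_one.2 (by linarith [stepError_pos hT])
    obtain ⟨π, h1, h2, h3⟩ := exists_coupling (localSearch d T) T x₀ hε hS.finds hS.confirms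
      fun x y hy z hz => outputProb_localSearch_congr d T x hy hz
    refine ⟨π, fun l => by rw [h1]; rfl, h2, le_trans (le_of_eq ?_) h3⟩
    rw [← ENNReal.ofReal_pow (by linarith [stepError_le hT]), one_sub_stepError_pow hT,
      ENNReal.ofReal_div_of_pos (by norm_num)]
    simp
  · refine expectedCalls_quantumHillClimber_le _ T x₀ (fun x => ?_) hS.calls_le
    have := one_le_log_inv_stepError hT
    have := searchBound_nonneg I.objective d x
    positivity
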